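/- For a homeomorphism $f$ of a topological space $X$ write $O_f(x)=\{f^n(x): n\in\mathbb Z\}$. Call $f$ *$R$-closed* if $\{(x,y)\in X\times X : y\in\overline{O_f(x)}\}$ is closed, *minimal* if every $O_f(x)$ is dense, and *periodic* if $f^n=\mathrm{id}$ for some $n\ge 1$. The *suspension* of $f$ is the space $X_f=(X\times\mathbb R)/\bigl((x,t+1)\sim(f(x),t)\bigr)$ with the flow $t\cdot[x,s]=[x,s+t]$. A (topological) foliation $\mathcal F$ of a manifold $N$ is called *$R$-closed* if $\{(z,w)\in N\times N : w\in\overline{L_z}\}$ is closed, where $L_z$ is the leaf through $z$; it is called *minimal* if every leaf is dense in $N$, and *compact* if every leaf is compact (in its leaf topology). (1) Let $M$ be homeomorphic to $\mathbb T^2$ or $\mathbb S^2$ and let $f:M\to M$ be an $R$-closed homeomorphism which is neither minimal nor periodic. Then $M_f$ is compact, Hausdorff and second countable, and the orbits of the suspension flow are the leaves of a topological foliation of $M_f$ with leaf dimension one and codimension two (so $M_f$ is a closed topological $3$-manifold). This foliation is $R$-closed, and it is neither minimal nor compact. (2) There are $R$-closed homeomorphisms of $\mathbb T^2$ that are neither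 minimal nor periodic, and there are $R$-closed homeomorphisms of $\mathbb S^2$ that are neither minimal nor periodic. (3) Examples for (2) arise as follows. Call a topological embedding $\iota:M\to\mathbb R^3$ *axisymmetric* if $\iota(M)$ is invariant under all rotations about the third coordinate axis. Both $\mathbb T^2$ and $\mathbb S^2$ have axisymmetric embeddings. If $M$ is homeomorphic to $\mathbb T^2$ or $\mathbb S^2$, $\iota:M\to\mathbb R^3$ is an axisymmetric embedding and $\alpha$ is irrational, then there is a homeomorphism $f:M\to M$ such that $\iota\circ f$ is $\iota$ followed by the rotation by the angle $2\pi\alpha$ about that axis, and $f$ is $R$-closed and neither minimal nor periodic. -/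

import Mathlib

open Set Topology

/-! ### `R`-closed families, homeomorphisms -/

/-- For a map `O` assigning to each point its orbit (or leaf), the relation
`{(x, y) | y ∈ closure (O x)}` is closed. -/
def RClosed {X : Type*} [TopologicalSpace X] (O : X → Set X) : Prop :=
  IsClosed {p : X × X | p.2 ∈ closure (O p.1)}

/-- The full orbit `{fⁿ x | n ∈ ℤ}` of `x` under a homeomorphism. -/
def homeoOrbit {X : Type*} [TopologicalSpace X] (f : X ≃ₜ X) (x : X) : Set X :=
  range fun n : ℤ => (f ^ n) x

def IsRClosedHomeo {X : Type*} [TopologicalSpace X] (f : X ≃ₜ X) : Prop :=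
  RClosed (homeoOrbit f)

def IsMinimalHomeo {X : Type*} [TopologicalSpace X] (f : X ≃ₜ X) : Prop :=
  ∀ x, Dense (homeoOrbit f x)

/-- Some positive iterate of `f` is the identity. -/
def IsPeriodicHomeo {X : Type*} [TopologicalSpace X] (f : X ≃ₜ X) : Prop :=
  ∃ n : ℕ, 0 < n ∧ f ^ n = 1

/-! ### The torus and the sphere -/

abbrev Torus2 : Type := Circle × Circle

abbrev Sphere2 : Type := Metric.sphere (0 : EuclideanSpace ℝ (Fin 3)) 1

def IsTorusOrSphere (M : Type*) [TopologicalSpace M] : Prop :=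
  Nonempty (M ≃ₜ Torus2) ∨ Nonempty (M ≃ₜ Sphere2)

/-! ### Topological foliations -/

/-- A map on `s ⊆ ℝᵖ × ℝ^q` which is continuous and locally of the form
`(x, y) ↦ (h₁ (x, y), h₂ y)`. -/
def IsFoliatedOn {E B : Type*} [TopologicalSpace E] [TopologicalSpace B]
    (f : E × B → E × B) (s : Set (E × B)) : Prop :=
  ContinuousOn f s ∧
    ∀ x ∈ s, ∃ V ∈ 𝓝 x, ∀ y ∈ V ∩ s, ∀ z ∈ V ∩ s, y.2 = z.2 → (f y).2 = (f z).2

/-- The pseudogroup of homeomorphisms between open subsets of `E × B` which locally have, together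
with their inverses, the form `(x, y) ↦ (h₁ (x, y), h₂ y)`. -/
def foliationGroupoid (E B : Type*) [TopologicalSpace E] [TopologicalSpace B] :
    StructureGroupoid (E × B) :=
  Pregroupoid.groupoid
    { property := IsFoliatedOn
      comp := by
        rintro f g u v ⟨hfc, hf⟩ ⟨hgc, hg⟩ _ _ huv
        refine ⟨hgc.comp (hfc.mono inter_subset_left) (fun x hx => hx.2), ?_⟩
        rintro x ⟨hxu, hxv⟩
        obtain ⟨V, hV, hVf⟩ := hf x hxu
        obtain ⟨W, hW, hWg⟩ := hg (f x) hxv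
        have hcont : ContinuousAt f x :=
          (hfc.mono inter_subset_left).continuousAt (huv.mem_nhds ⟨hxu, hxv⟩)
        refine ⟨V ∩ f ⁻¹' W, Filter.inter_mem hV (hcont hW), ?_⟩
        rintro y ⟨⟨hyV, hyW⟩, hyu, hyv⟩ z ⟨⟨hzV, hzW⟩, hzu, hzv⟩ hyz
        exact hWg _ ⟨hyW, hyv⟩ _ ⟨hzW, hzv⟩ (hVf y ⟨hyV, hyu⟩ z ⟨hzV, hzu⟩ hyz)
      id_mem := ⟨continuousOn_id, fun _ _ => ⟨univ, Filter.univ_mem, fun _ _ _ _ h => h⟩⟩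
      locality := by
        intro f u hu h
        refine ⟨fun x hx => ?_, fun x hx => ?_⟩
        · obtain ⟨v, hv, hxv, hc, _⟩ := h x hx
          exact (hc.continuousAt ((hu.inter hv).mem_nhds ⟨hx, hxv⟩)).continuousWithinAt
        · obtain ⟨v, hv, hxv, _, hf⟩ := h x hx
          obtain ⟨V, hV, hVf⟩ := hf x ⟨hx, hxv⟩
          refine ⟨V ∩ v, Filter.inter_mem hV (hv.mem_nhds hxv), ?_⟩
          rintro y ⟨⟨hyV, hyv⟩, hyu⟩ z ⟨⟨hzV, hzv⟩, hzu⟩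
          exact hVf y ⟨hyV, hyu, hyv⟩ z ⟨hzV, hzu, hzv⟩
      congr := by
        rintro f g u _ hfg ⟨hc, hf⟩
        refine ⟨hc.congr hfg, fun x hx => ?_⟩
        obtain ⟨V, hV, hVf⟩ := hf x hx
        refine ⟨V, hV, fun y hy z hz hyz => ?_⟩
        rw [hfg y hy.2, hfg z hz.2]
        exact hVf y hy z hz hyz }

/-- A (topological) foliation of leaf dimension `p` and codimension `q`, given by a foliated
atlas. -/
structure Foliation (p q : ℕ) (M : Type*) [TopologicalSpace M] where
  charted : ChartedSpace (EuclideanSpace ℝ (Fin p) × EuclideanSpace ℝ (Fin q)) M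
  compatible : HasGroupoid M
    (foliationGroupoid (EuclideanSpace ℝ (Fin p)) (EuclideanSpace ℝ (Fin q)))

namespace Foliation

variable {p q : ℕ} {M : Type*} [TopologicalSpace M] (F : Foliation p q M)

/-- The leaf topology on `M`, generated by the (relatively) open subsets of the level sets of the
transverse coordinate in the foliated charts. -/
abbrev leafTopology : TopologicalSpace M :=
  TopologicalSpace.generateFrom
    {P | ∃ e ∈ F.charted.atlas, ∃ c : EuclideanSpace ℝ (Fin q), ∃ U : Set M, IsOpen U ∧
      P = {x | x ∈ U ∧ x ∈ e.source ∧ (e x).2 = c}}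

/-- The leaf through `x`: its connected component in the leaf topology. -/
def leaf (x : M) : Set M :=
  @connectedComponent M F.leafTopology x

/-- `{(x, y) | y ∈ closure (leaf x)}` is closed; closures are taken in `M`. -/
def IsRClosed : Prop :=
  RClosed F.leaf

/-- Every leaf is dense in `M`. -/
def IsMinimal : Prop :=
  ∀ x, Dense (F.leaf x)

/-- Every leaf is compact in the leaf topology. -/
def IsCompactFoliation : Prop :=
  ∀ x, @IsCompact M F.leafTopology (F.leaf x)

end Foliation

/-! ### The suspension of a homeomorphism -/

section Suspension

variable {X : Type*} [TopologicalSpace X] (f : X ≃ₜ X)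

/-- The equivalence relation on `X × ℝ` generated by `(x, t + 1) ∼ (f x, t)`. -/
def suspensionSetoid : Setoid (X × ℝ) where
  r a b := ∃ n : ℤ, b.1 = (f ^ n) a.1 ∧ a.2 = b.2 + n
  iseqv :=
    { refl := fun a => ⟨0, by simp, by simp⟩
      symm := by
        rintro a b ⟨n, h1, h2⟩
        refine ⟨-n, ?_, by push_cast; linarith⟩
        rw [h1, ← Homeomorph.mul_apply, ← zpow_add]
        simp
      trans := by
        rintro a b c ⟨n, h1, h2⟩ ⟨m, h3, h4⟩
        refine ⟨m + n, ?_, by push_cast; linarith⟩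
        rw [h3, h1, zpow_add, Homeomorph.mul_apply] }

/-- The suspension space (mapping torus) `X × ℝ / (x, t + 1) ∼ (f x, t)`, with the quotient
topology. -/
def Suspension : Type _ := Quotient (suspensionSetoid f)

instance : TopologicalSpace (Suspension f) :=
  inferInstanceAs (TopologicalSpace (Quotient (suspensionSetoid f)))

namespace Suspension

def mk (a : X × ℝ) : Suspension f := Quotient.mk (suspensionSetoid f) a

theorem isQuotientMap_mk : IsQuotientMap (mk f) := isQuotientMap_quotient_mk'

theorem continuous_mk : Continuous (mk f) := (isQuotientMap_mk f).continuous

theorem isOpenMap_mk : IsOpenMap (mk f) := by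
  intro U hU
  rw [← (isQuotientMap_mk f).isOpen_preimage]
  have : mk f ⁻¹' (mk f '' U) =
      ⋃ n : ℤ, (fun a : X × ℝ => ((f ^ n) a.1, a.2 - (n : ℝ))) ⁻¹' U := by
    ext b
    simp only [mem_preimage, mem_image, mem_iUnion]
    constructor
    · rintro ⟨a, ha, hab⟩
      obtain ⟨n, h1, h2⟩ := (suspensionSetoid f).symm (Quotient.exact hab)
      refine ⟨n, ?_⟩
      have : ((f ^ n) b.1, b.2 - (n : ℝ)) = a := Prod.ext h1.symm (by simp [h2])
      rwa [this]
    · rintro ⟨n, hn⟩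
      exact ⟨_, hn, Quotient.sound ((suspensionSetoid f).symm ⟨n, rfl, by simp⟩)⟩
  rw [this]
  refine isOpen_iUnion fun n => hU.preimage ?_
  exact ((f ^ n).continuous.comp continuous_fst).prodMk (continuous_snd.sub continuous_const)

theorem isOpenQuotientMap_mk : IsOpenQuotientMap (mk f) :=
  ⟨(isQuotientMap_mk f).surjective, continuous_mk f, isOpenMap_mk f⟩

/-- The suspension flow, `t ↦ ([x, s] ↦ [x, s + t])`. -/
def flow : Flow ℝ (Suspension f) where
  toFun t := Quotient.map' (s₁ := suspensionSetoid f) (s₂ := suspensionSetoid f)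
    (fun a => (a.1, a.2 + t)) (by
      rintro a b ⟨n, h1, h2⟩
      exact ⟨n, h1, by simp only; linarith⟩)
  cont' := by
    refine (IsOpenQuotientMap.id.prodMap (isOpenQuotientMap_mk f)).isQuotientMap.continuous_iff.2 ?_
    exact (continuous_mk f).comp ((continuous_fst.comp continuous_snd).prodMk
      ((continuous_snd.comp continuous_snd).add continuous_fst))
  map_add' := by
    rintro s t ⟨a⟩
    refine congrArg (mk f) (Prod.ext rfl ?_)
    simp only; ring
  map_zero' := by
    rintro ⟨a⟩
    exact congrArg (mk f) (Prod.ext rfl (by simp))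

/-- `F` is the foliation of the suspension space induced by the suspension: its leaves are the
orbits of the suspension flow. -/
def IsInducedFoliation {p q : ℕ} (F : Foliation p q (Suspension f)) : Prop :=
  ∀ z, F.leaf z = range fun t : ℝ => flow f t z

end Suspension

end Suspension

/-! ### Rotations about an axis in space -/

/-- The rotation of `ℝ³` by the angle `θ` about the third coordinate axis. -/
noncomputable def axisRotation (θ : ℝ) (v : EuclideanSpace ℝ (Fin 3)) :
    EuclideanSpace ℝ (Fin 3) :=
  !₂[Real.cos θ * v 0 - Real.sin θ * v 1, Real.sin θ * v 0 + Real.cos θ * v 1, v 2]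

/-- A topological embedding into `ℝ³` whose image is invariant under all rotations about the
axis. -/
def IsAxisymmetricEmbedding {M : Type*} [TopologicalSpace M]
    (ι : M → EuclideanSpace ℝ (Fin 3)) : Prop :=
  IsEmbedding ι ∧ ∀ θ : ℝ, axisRotation θ '' range ι = range ι

/-! The suspension reduces to its base. The map `X × ℝ → Suspension f` is an open quotient map, so
the closure of a flow line pulls back to the closure of an orbit of `f` times `ℝ`; this transports
`R`-closedness and non-density (`Suspension.rClosed_orbit`, `Suspension.not_dense_orbit`). Charts of
the surface times time windows of length one form a foliated atlas. In its leaf topology flow lines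
are clopen and connected, so they are the leaves (`Suspension.isInducedFoliation_flowFoliation`). A
compact leaf is covered by finitely many plaques, which makes its base point periodic.

The deep point is non-compactness: if all leaves were compact, `f` would be pointwise periodic, and
by Montgomery's theorem (`isPeriodicHomeo_of_pointwise`) periodic. That theorem follows from Baire
category and the local form of Newman's theorem (`eventually_fixed_of_period`): a locally periodic
map fixing an open set adherent to `a` is the identity near `a`.

Newman's theorem is proved by counting zeros, with winding numbers encoded by continuous logarithms
(`LogEquivOn`). For prime period `q`, an inversion arranges that everything outside a disc is fixed,
with moved points accumulating at a boundary point `a` (`false_of_fixed_outside_disc`). Let `A` be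
the average of the coordinate over the cycle. Around a small circle about `a`, `A` winds once about
the coordinate of a fixed point just outside the disc, since it takes this value only there and
agrees with the coordinate nearby. About the coordinate of a nearby moved point it winds equally
often; but its preimages are free orbits, so the invariance of `A` makes this number a multiple of
`q` (`exists_logEquivOn_zpow_of_free_zeros`). Hence `q ∣ 1`.

For an irrational rotation, orbit closures are the sets of constant height and distance to the axis
(`mem_closure_orbit_iff`), a closed relation. Minimality would put the surface in one circle,
periodicity in the axis; `not_forall_finite_fiber` excludes both. -/

/-! ### Continuous logarithms and winding numbers -/

/-- `u` and `w` differ on `S` by a factor with a continuous logarithm. -/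
def LogEquivOn {Y : Type*} [TopologicalSpace Y] (S : Set Y) (u w : Y → ℂ) : Prop :=
  ∃ g : Y → ℂ, ContinuousOn g S ∧ ∀ y ∈ S, u y = w y * Complex.exp (g y)

namespace LogEquivOn

variable {Y : Type*} [TopologicalSpace Y] {S : Set Y} {u w x u' w' : Y → ℂ}

theorem refl (S : Set Y) (u : Y → ℂ) : LogEquivOn S u u :=
  ⟨0, continuousOn_const, fun y _ => by simp⟩

theorem symm (h : LogEquivOn S u w) : LogEquivOn S w u := by
  obtain ⟨g, hg, h⟩ := h
  refine ⟨-g, hg.neg, fun y hy => ?_⟩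
  rw [h y hy, mul_assoc, ← Complex.exp_add]
  simp

theorem trans (h : LogEquivOn S u w) (h' : LogEquivOn S w x) : LogEquivOn S u x := by
  obtain ⟨g, hg, h⟩ := h
  obtain ⟨g', hg', h'⟩ := h'
  refine ⟨g' + g, hg'.add hg, fun y hy => ?_⟩
  rw [h y hy, h' y hy, mul_assoc, ← Complex.exp_add, Pi.add_apply]

theorem mul (h : LogEquivOn S u w) (h' : LogEquivOn S u' w') :
    LogEquivOn S (fun y => u y * u' y) (fun y => w y * w' y) := by
  obtain ⟨g, hg, h⟩ := h
  obtain ⟨g', hg', h'⟩ := h'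
  refine ⟨g + g', hg.add hg', fun y hy => ?_⟩
  simp only [h y hy, h' y hy, Pi.add_apply, Complex.exp_add]
  ring

theorem zpow (h : LogEquivOn S u w) (n : ℤ) :
    LogEquivOn S (fun y => u y ^ n) (fun y => w y ^ n) := by
  obtain ⟨g, hg, h⟩ := h
  refine ⟨fun y => n * g y, continuousOn_const.mul hg, fun y hy => ?_⟩
  simp only [h y hy, mul_zpow, Complex.exp_int_mul]

theorem prod {ι : Type*} (s : Finset ι) {u w : ι → Y → ℂ} (h : ∀ i ∈ s, LogEquivOn S (u i) (w i)) :
    LogEquivOn S (fun y => ∏ i ∈ s, u i y) (fun y => ∏ i ∈ s, w i y) := by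
  classical
  induction s using Finset.induction_on with
  | empty => simpa using refl S _
  | insert a s ha ih =>
    simp only [Finset.prod_insert ha]
    exact (h a (by simp)).mul (ih fun i hi => h i (by simp [hi]))

theorem of_slitPlane (hu : ContinuousOn u S) (hw : ContinuousOn w S) (hw0 : ∀ y ∈ S, w y ≠ 0)
    (h : ∀ y ∈ S, u y / w y ∈ Complex.slitPlane) : LogEquivOn S u w := by
  refine ⟨fun y => Complex.log (u y / w y), (hu.div hw hw0).clog h, fun y hy => ?_⟩
  rw [Complex.exp_log (Complex.slitPlane_ne_zero (h y hy)), mul_div_cancel₀ _ (hw0 y hy)]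

end LogEquivOn

/-- If `z - a = -t (z - b)` with `t ≥ 0`, then `z = (a + t b) / (1 + t)` is a convex combination of
`a` and `b`. -/
theorem Complex.div_mem_slitPlane_of_notMem_segment {z a b : ℂ} (h : z ∉ segment ℝ a b) :
    (z - a) / (z - b) ∈ Complex.slitPlane := by
  by_contra hn
  rw [Complex.mem_slitPlane_iff_not_le_zero, not_not] at hn
  obtain ⟨t, ht, h0⟩ : ∃ t : ℝ, 0 ≤ t ∧ (z - a) / (z - b) = -(t : ℂ) := by
    refine ⟨-((z - a) / (z - b)).re, ?_, ?_⟩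
    · simpa using (Complex.le_def.1 hn).1
    · apply Complex.ext
      · simp
      · simpa using (Complex.le_def.1 hn).2
  have hb : z - b ≠ 0 := fun hb => h (by
    rw [sub_eq_zero.1 hb]; exact right_mem_segment _ _ _)
  rw [div_eq_iff hb] at h0
  refine h ⟨1 / (1 + t), t / (1 + t), by positivity, by positivity, by field_simp, ?_⟩
  have h1 : (1 + t : ℂ) ≠ 0 := by exact_mod_cast (by positivity : (1 + t : ℝ) ≠ 0)
  simp only [Complex.real_smul]
  push_cast
  field_simp
  linear_combination -h0

/-- The winding number is unchanged when its centre moves along a segment that `u` avoids; the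
principal branch of the logarithm of the quotient is the witness. -/
theorem logEquivOn_sub_of_segment {Y : Type*} [TopologicalSpace Y] {S : Set Y} {u : Y → ℂ}
    (hu : ContinuousOn u S) {a b : ℂ} (h : ∀ y ∈ S, u y ∉ segment ℝ a b) :
    LogEquivOn S (fun y => u y - a) (fun y => u y - b) :=
  .of_slitPlane (hu.sub continuousOn_const) (hu.sub continuousOn_const)
    (fun y hy h0 => h y hy (by rw [sub_eq_zero.1 h0]; exact right_mem_segment _ _ _))
    fun y hy => Complex.div_mem_slitPlane_of_notMem_segment (h y hy)

theorem exists_log_of_contractible {X : Type*} [TopologicalSpace X] [LocallyPathConnectedSpace X]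
    [SimplyConnectedSpace X] {u : X → ℂ} (hu : Continuous u) (h0 : ∀ x, u x ≠ 0) :
    ∃ g : X → ℂ, Continuous g ∧ ∀ x, u x = Complex.exp (g x) := by
  have hs : IsSimplyConnected (univ : Set X) := by
    have e := Homeomorph.Set.univ X
    exact e.toHomotopyEquiv.simplyConnectedSpace
  obtain ⟨g, hg, h⟩ := Complex.exists_continuousOn_eqOn_exp_comp hs isOpen_univ
    hu.continuousOn (by rintro ⟨x, -, hx⟩; exact h0 x hx)
  exact ⟨g, continuousOn_univ.1 hg, fun x => (h (mem_univ x)).symm⟩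

theorem exists_log_closedBall {c : ℂ} {r : ℝ} (hr : 0 ≤ r) {u : ℂ → ℂ}
    (hu : ContinuousOn u (Metric.closedBall c r)) (h0 : ∀ z ∈ Metric.closedBall c r, u z ≠ 0) :
    ∃ g : ℂ → ℂ, ContinuousOn g (Metric.closedBall c r) ∧
      ∀ z ∈ Metric.closedBall c r, u z = Complex.exp (g z) := by
  have hc : Convex ℝ (Metric.closedBall c r) := convex_closedBall c r
  have := hc.locallyPathConnectedSpace
  have := hc.contractibleSpace ⟨c, by simpa using hr⟩
  obtain ⟨g, hg, h⟩ := exists_log_of_contractible (X := Metric.closedBall c r)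
    (continuousOn_iff_continuous_domRestrict.1 hu) (fun x => h0 x x.2)
  classical
  refine ⟨fun z => if hz : z ∈ Metric.closedBall c r then g ⟨z, hz⟩ else 0, ?_, ?_⟩
  · rw [continuousOn_iff_continuous_domRestrict]
    convert hg using 1
    ext x
    exact dif_pos x.2
  · intro z hz
    simp only [dif_pos hz, ← h ⟨z, hz⟩]
    rfl

theorem exists_int_mul_of_exp_eq_one {X : Type*} [TopologicalSpace X] [PreconnectedSpace X]
    {F : X → ℂ} (hF : Continuous F) (h : ∀ x, Complex.exp (F x) = 1) :
    ∃ k : ℤ, ∀ x, F x = k * (2 * Real.pi * Complex.I) := by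
  choose k hk using fun x => Complex.exp_eq_one_iff.1 (h x)
  have hk' : ∀ x, (k x : ℝ) = (F x / (2 * Real.pi * Complex.I)).re := by
    intro x
    rw [hk x, mul_div_cancel_right₀ _ Complex.two_pi_I_ne_zero, Complex.intCast_re]
  have hc : Continuous k := by
    rw [Int.isClosedEmbedding_coe_real.isEmbedding.continuous_iff]
    have : ((↑) : ℤ → ℝ) ∘ k = fun x => (F x / (2 * Real.pi * Complex.I)).re := funext hk'
    rw [this]
    fun_prop
  rcases isEmpty_or_nonempty X with hX | ⟨⟨x₀⟩⟩
  · exact ⟨0, fun x => (hX.false x).elim⟩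
  · refine ⟨k x₀, fun x => ?_⟩
    rw [hk x, PreconnectedSpace.constant inferInstance hc (x := x) (y := x₀)]

theorem exp_log_add_mul_I {c : ℂ} {r : ℝ} (hr : 0 < r) (n : ℤ) (θ : ℝ) :
    Complex.exp (n * (Real.log r + θ * Complex.I)) = (circleMap c r θ - c) ^ n := by
  rw [circleMap_sub_center, circleMap_zero, Complex.exp_int_mul, Complex.exp_add,
    ← Complex.ofReal_exp, Real.exp_log hr]

/-- Uniqueness of the winding number: along one turn a logarithm of `(z - c) ^ n` grows by `2πin`,
whereas `g` returns to its value. -/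
theorem eq_zero_of_zpow_eq_exp_on_sphere {c : ℂ} {r : ℝ} (hr : 0 < r) {n : ℤ} {g : ℂ → ℂ}
    (hg : ContinuousOn g (Metric.sphere c r))
    (h : ∀ z ∈ Metric.sphere c r, (z - c) ^ n = Complex.exp (g z)) : n = 0 := by
  have hmem : ∀ θ : ℝ, circleMap c r θ ∈ Metric.sphere c r :=
    fun θ => circleMap_mem_sphere c hr.le θ
  have hG : Continuous fun θ : ℝ => g (circleMap c r θ) - n * (Real.log r + θ * Complex.I) := by
    have h1 : Continuous fun θ : ℝ => g (circleMap c r θ) :=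
      hg.comp_continuous (continuous_circleMap c r) hmem
    exact h1.sub (by fun_prop)
  obtain ⟨k, hk⟩ := exists_int_mul_of_exp_eq_one hG fun θ => by
    rw [Complex.exp_sub, ← h _ (hmem θ), ← exp_log_add_mul_I hr]
    exact div_self (Complex.exp_ne_zero _)
  have h0 := hk 0
  have h1 := hk (2 * Real.pi)
  rw [← zero_add (2 * Real.pi), periodic_circleMap c r 0] at h1
  have h2 : (n : ℂ) * (2 * Real.pi * Complex.I) = 0 := by
    push_cast at h0 h1
    linear_combination h0 - h1
  simpa [Complex.two_pi_I_ne_zero] using h2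

/-- Existence of the winding number: lift to a logarithm over `ℝ`, read off `d` from its constant
increment over a period, and remove a linear term to get a periodic function. -/
theorem exists_zpow_mul_exp_on_sphere {c : ℂ} {r : ℝ} (hr : 0 < r) {u : ℂ → ℂ}
    (hu : ContinuousOn u (Metric.sphere c r)) (h0 : ∀ z ∈ Metric.sphere c r, u z ≠ 0) :
    ∃ (d : ℤ) (g : ℂ → ℂ), ContinuousOn g (Metric.sphere c r) ∧
      ∀ z ∈ Metric.sphere c r, u z = (z - c) ^ d * Complex.exp (g z) := by
  have hmem : ∀ θ : ℝ, circleMap c r θ ∈ Metric.sphere c r :=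
    fun θ => circleMap_mem_sphere c hr.le θ
  obtain ⟨G, hG, hGu⟩ := exists_log_of_contractible (X := ℝ)
    (hu.comp_continuous (continuous_circleMap c r) hmem) (fun θ => h0 _ (hmem θ))
  obtain ⟨d, hd⟩ := exists_int_mul_of_exp_eq_one
    (F := fun θ : ℝ => G (θ + 2 * Real.pi) - G θ) (by fun_prop) fun θ => by
      rw [Complex.exp_sub, ← hGu, ← hGu, Function.comp_apply, Function.comp_apply,
        periodic_circleMap c r θ]
      exact div_self (h0 _ (hmem θ))
  set Φ : ℝ → ℂ := fun θ => G θ - d * (Real.log r + θ * Complex.I) with hΦ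
  have hΦc : Continuous Φ := by fun_prop
  have hper : Function.Periodic Φ (2 * Real.pi) := by
    intro θ
    simp only [hΦ]
    push_cast
    linear_combination hd θ
  -- `arg` jumps, but `Φ` is periodic, so `γ` composed with the quotient map `Circle.exp` is `Φ` and
  -- `γ` is continuous.
  let γ : Circle → ℂ := fun w => Φ (Complex.arg w)
  have hγ : ∀ θ : ℝ, γ (Circle.exp θ) = Φ θ := by
    intro θ
    obtain ⟨m, hm⟩ := Circle.exp_eq_exp.1 (Circle.exp_arg (Circle.exp θ))
    simp only [γ, hm]
    exact hper.int_mul m θ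
  have hq : IsQuotientMap Circle.exp :=
    Circle.isCoveringMap_exp.isQuotientMap (fun w => ⟨_, Circle.exp_arg w⟩)
  have hγc : Continuous γ := by
    rw [hq.continuous_iff]
    exact (funext hγ : γ ∘ Circle.exp = Φ) ▸ hΦc
  have hnorm : ∀ z ∈ Metric.sphere c r, (z - c) / r ∈ Submonoid.unitSphere ℂ := by
    intro z hz
    rw [mem_sphere_iff_norm] at hz
    rw [Submonoid.unitSphere, Submonoid.mem_mk]
    simp [hz, abs_of_pos hr, hr.ne']
  classical
  refine ⟨d, fun z => if hz : z ∈ Metric.sphere c r then γ ⟨(z - c) / r, hnorm z hz⟩ else 0,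
    ?_, ?_⟩
  · rw [continuousOn_iff_continuous_domRestrict]
    have : Continuous fun z : Metric.sphere c r => γ ⟨(z - c) / r, hnorm z z.2⟩ :=
      hγc.comp (Continuous.subtype_mk (by fun_prop) _)
    convert this using 1
    ext z
    exact dif_pos z.2
  · intro z hz
    obtain ⟨θ, rfl⟩ : ∃ θ, circleMap c r θ = z := by
      rwa [← abs_of_pos hr, ← range_circleMap] at hz
    have h1 : (⟨(circleMap c r θ - c) / r, hnorm _ hz⟩ : Circle) = Circle.exp θ := by
      apply Circle.ext
      have : (r : ℂ) ≠ 0 := by exact_mod_cast hr.ne'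
      simp [circleMap, this]
    simp only [dif_pos hz, h1, hγ]
    rw [← exp_log_add_mul_I hr, ← Complex.exp_add, hΦ]
    simp only [add_sub_cancel]
    exact hGu θ

theorem Finset.prod_range_shift {A : Type*} [CommMonoid A] {a : ℕ → A} {q : ℕ} (h : a q = a 0) :
    ∏ i ∈ Finset.range q, a (i + 1) = ∏ i ∈ Finset.range q, a i := by
  cases q with
  | zero => rfl
  | succ n => rw [Finset.prod_range_succ, h, Finset.prod_range_succ']

theorem Finset.sum_range_shift {A : Type*} [AddCommMonoid A] {a : ℕ → A} {q : ℕ} (h : a q = a 0) :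
    ∑ i ∈ Finset.range q, a (i + 1) = ∑ i ∈ Finset.range q, a i := by
  cases q with
  | zero => rfl
  | succ n => rw [Finset.sum_range_succ, h, Finset.sum_range_succ']

theorem exists_continuous_extension {A : Set ℂ} (hA : IsClosed A) {w : ℂ → ℂ}
    (hw : ContinuousOn w A) : ∃ W : ℂ → ℂ, Continuous W ∧ EqOn W w A := by
  obtain ⟨W, hW⟩ := ContinuousMap.exists_restrict_eq hA
    ⟨A.domRestrict w, continuousOn_iff_continuous_domRestrict.1 hw⟩
  exact ⟨W, W.continuous, fun z hz => congr($hW ⟨z, hz⟩)⟩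

/-! ### Functions read in a planar coordinate -/

section Coordinate

variable {Y : Type*} [TopologicalSpace Y] {e : Y → ℂ}

/-- Tietze extension in the plane: statements about discs and circles in `ℂ` become available on `Y`
with globally continuous witnesses. -/
theorem Topology.IsOpenEmbedding.exists_pushforward (he : IsOpenEmbedding e) {A : Set ℂ}
    (hA : IsClosed A) (hAe : A ⊆ range e) {w : Y → ℂ} (hw : ContinuousOn w (e ⁻¹' A)) :
    ∃ W : ℂ → ℂ, Continuous W ∧ ∀ y, e y ∈ A → W (e y) = w y := by
  rcases isEmpty_or_nonempty Y with hY | hY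
  · exact ⟨0, continuous_const, fun y => (hY.false y).elim⟩
  let E := he.toOpenPartialHomeomorph e
  have hl : ∀ y, E.symm (e y) = y := fun y => E.left_inv (x := y) (by simp [E])
  obtain ⟨W, hW, h⟩ := exists_continuous_extension (w := fun z => w (E.symm z)) hA (by
    refine hw.comp (E.symm.continuousOn.mono (by simpa [E] using hAe)) fun z hz => ?_
    obtain ⟨y, rfl⟩ := hAe hz
    rwa [mem_preimage, hl])
  exact ⟨W, hW, fun y hy => by simp [h hy, hl]⟩

theorem Topology.IsOpenEmbedding.isCompact_preimage_of_subset_range (he : IsOpenEmbedding e)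
    {A : Set ℂ} (hA : IsCompact A) (hAe : A ⊆ range e) : IsCompact (e ⁻¹' A) := by
  rw [he.isEmbedding.isCompact_iff, image_preimage_eq_of_subset hAe]
  exact hA

theorem Topology.IsOpenEmbedding.exists_log_on_disc (he : IsOpenEmbedding e) {a : ℂ} {r : ℝ}
    (hr : 0 ≤ r) (hAe : Metric.closedBall a r ⊆ range e) {w : Y → ℂ}
    (hw : ContinuousOn w (e ⁻¹' Metric.closedBall a r))
    (h0 : ∀ y, e y ∈ Metric.closedBall a r → w y ≠ 0) :
    ∃ G : Y → ℂ, Continuous G ∧ ∀ y, e y ∈ Metric.closedBall a r → w y = Complex.exp (G y) := by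
  obtain ⟨W, hW, hWw⟩ := he.exists_pushforward Metric.isClosed_closedBall hAe hw
  obtain ⟨g, hg, h⟩ := exists_log_closedBall hr hW.continuousOn (by
    intro z hz
    obtain ⟨y, rfl⟩ := hAe hz
    rw [hWw y hz]
    exact h0 y hz)
  obtain ⟨G, hG, hGg⟩ := exists_continuous_extension Metric.isClosed_closedBall hg
  exact ⟨fun y => G (e y), hG.comp he.continuous, fun y hy => by
    rw [← hWw y hy, h _ hy, ← hGg hy]⟩

theorem Topology.IsOpenEmbedding.exists_zpow_log_on_circle (he : IsOpenEmbedding e) {a : ℂ} {r : ℝ}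
    (hr : 0 < r) (hAe : Metric.sphere a r ⊆ range e) {w : Y → ℂ}
    (hw : ContinuousOn w (e ⁻¹' Metric.sphere a r))
    (h0 : ∀ y, e y ∈ Metric.sphere a r → w y ≠ 0) :
    ∃ (d : ℤ) (G : Y → ℂ), Continuous G ∧
      ∀ y, e y ∈ Metric.sphere a r → w y = (e y - a) ^ d * Complex.exp (G y) := by
  obtain ⟨W, hW, hWw⟩ := he.exists_pushforward Metric.isClosed_sphere hAe hw
  obtain ⟨d, g, hg, h⟩ := exists_zpow_mul_exp_on_sphere hr hW.continuousOn (by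
    intro z hz
    obtain ⟨y, rfl⟩ := hAe hz
    rw [hWw y hz]
    exact h0 y hz)
  obtain ⟨G, hG, hGg⟩ := exists_continuous_extension Metric.isClosed_sphere hg
  exact ⟨d, fun y => G (e y), hG.comp he.continuous, fun y hy => by
    rw [← hWw y hy, h _ hy, ← hGg hy]⟩

/-- A continuous function can be approximated, on a disc, by a continuous function without zeros
on a given circle. -/
theorem Topology.IsOpenEmbedding.exists_approx_ne_zero_on_circle (he : IsOpenEmbedding e) {a : ℂ}
    {r R : ℝ} (hAe : Metric.closedBall a R ⊆ range e) {w : Y → ℂ}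
    (hw : Continuous w) {ε : ℝ} (hε : 0 < ε) :
    ∃ u : Y → ℂ, Continuous u ∧ (∀ y, e y ∈ Metric.closedBall a R → dist (u y) (w y) < ε) ∧
      ∀ y, e y ∈ Metric.sphere a r → u y ≠ 0 := by
  obtain ⟨W, hW, hWw⟩ := he.exists_pushforward Metric.isClosed_closedBall hAe hw.continuousOn
  obtain ⟨P, hP, hPW, -⟩ := hW.exists_contDiff_approx 1 (ε := fun _ => ε / 2) continuous_const
    fun _ => half_pos hε
  have hPc : ContDiff ℝ 1 fun θ : ℝ => P (circleMap a r θ) :=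
    hP.comp (contDiff_circleMap a r)
  -- A `C¹` image of a line in the plane has dense complement, so a small constant off the curve can
  -- be subtracted.
  have hd := hPc.dense_compl_range_of_finrank_lt_finrank (by simp)
  obtain ⟨c, hc, hcε⟩ := hd.exists_dist_lt 0 (half_pos hε)
  refine ⟨fun y => P (e y) - c, (hP.continuous.comp he.continuous).sub continuous_const,
    fun y hy => ?_, fun y hy h => hc ?_⟩
  · rw [← hWw y hy]
    calc dist (P (e y) - c) (W (e y)) ≤ dist (P (e y) - c) (P (e y)) + dist (P (e y)) (W (e y)) :=
          dist_triangle _ _ _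
      _ < ε / 2 + ε / 2 := by
          refine add_lt_add ?_ (hPW _)
          rw [dist_comm, dist_zero_right] at *
          simpa [dist_eq_norm] using hcε
      _ = ε := by ring
  · have hr : 0 ≤ r := dist_nonneg.trans_eq (Metric.mem_sphere.1 hy)
    rw [← abs_of_nonneg hr, ← range_circleMap] at hy
    obtain ⟨θ, hθ⟩ := hy
    exact ⟨θ, by simp only [hθ]; exact sub_eq_zero.1 h⟩

end Coordinate

/-! ### Functions invariant under a homeomorphism of finite order -/

section Cyclic

variable {Y : Type*} [TopologicalSpace Y] {h : Y ≃ₜ Y} {q : ℕ}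

/-- The points with one of `y, h y, …, h^(q-1) y` in `B`. -/
def cycleSaturation (h : Y ≃ₜ Y) (q : ℕ) (B : Set Y) : Set Y :=
  {y | ∃ i < q, (h ^ i) y ∈ B}

theorem subset_cycleSaturation (hq : 0 < q) (B : Set Y) : B ⊆ cycleSaturation h q B :=
  fun _ hy => ⟨0, hq, hy⟩

theorem cycleSaturation_mono {B C : Set Y} (hBC : B ⊆ C) :
    cycleSaturation h q B ⊆ cycleSaturation h q C :=
  fun _ ⟨i, hi, hy⟩ => ⟨i, hi, hBC hy⟩

theorem cycleSaturation_eq_iUnion (B : Set Y) :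
    cycleSaturation h q B = ⋃ i ∈ Finset.range q, (h ^ i) ⁻¹' B := by
  ext y; simp [cycleSaturation]

theorem IsOpen.cycleSaturation {B : Set Y} (hB : IsOpen B) : IsOpen (cycleSaturation h q B) := by
  rw [cycleSaturation_eq_iUnion]
  exact isOpen_biUnion fun i _ => hB.preimage (h ^ i).continuous

theorem IsClosed.cycleSaturation {B : Set Y} (hB : IsClosed B) :
    IsClosed (cycleSaturation h q B) := by
  rw [cycleSaturation_eq_iUnion]
  exact isClosed_biUnion_finset fun i _ => hB.preimage (h ^ i).continuous

theorem Homeomorph.pow_apply_apply (h : Y ≃ₜ Y) (i : ℕ) (y : Y) : (h ^ i) (h y) = (h ^ (i + 1)) y := by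
  rw [pow_succ, Homeomorph.mul_apply]

theorem mem_cycleSaturation_apply_iff (hq : h ^ q = 1) {B : Set Y} {y : Y} :
    h y ∈ cycleSaturation h q B ↔ y ∈ cycleSaturation h q B := by
  constructor
  · rintro ⟨i, hi, hy⟩
    rw [h.pow_apply_apply] at hy
    rcases (Nat.succ_le_of_lt hi).lt_or_eq with h1 | h1
    · exact ⟨i + 1, h1, hy⟩
    · refine ⟨0, by lia, ?_⟩
      rw [← Nat.succ_eq_add_one, h1, hq] at hy
      simpa using hy
  · rintro ⟨i, hi, hy⟩
    cases i with
    | zero =>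
      refine ⟨q - 1, by lia, ?_⟩
      rw [h.pow_apply_apply, Nat.sub_add_cancel hi, hq]
      simpa using hy
    | succ i => exact ⟨i, by lia, by rwa [h.pow_apply_apply]⟩

theorem apply_pow_eq_of_invariant {Z : Type*} {v : Y → Z} (hv : ∀ y, v (h y) = v y) (i : ℕ) (y : Y) :
    v ((h ^ i) y) = v y := by
  induction i with
  | zero => simp
  | succ i ih => rw [pow_succ', Homeomorph.mul_apply, hv, ih]

/-- `∏ (e (hⁱ y) - e c)` over a full cycle. -/
def orbitProd (h : Y ≃ₜ Y) (q : ℕ) (e : Y → ℂ) (c y : Y) : ℂ :=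
  ∏ i ∈ Finset.range q, (e ((h ^ i) y) - e c)

def orbitSum (h : Y ≃ₜ Y) (q : ℕ) (u : Y → ℂ) (y : Y) : ℂ :=
  ∑ i ∈ Finset.range q, u ((h ^ i) y)

theorem orbitProd_apply (hq : h ^ q = 1) (e : Y → ℂ) (c y : Y) :
    orbitProd h q e c (h y) = orbitProd h q e c y := by
  simp only [orbitProd, h.pow_apply_apply]
  exact Finset.prod_range_shift (a := fun i => e ((h ^ i) y) - e c) (by simp [hq])

theorem orbitSum_apply (hq : h ^ q = 1) (u : Y → ℂ) (y : Y) :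
    orbitSum h q u (h y) = orbitSum h q u y := by
  simp only [orbitSum, h.pow_apply_apply]
  exact Finset.sum_range_shift (a := fun i => u ((h ^ i) y)) (by simp [hq])

theorem Continuous.orbitProd {e : Y → ℂ} (he : Continuous e) (c : Y) :
    Continuous (orbitProd h q e c) :=
  continuous_finsetProd _ fun i _ => (he.comp (h ^ i).continuous).sub continuous_const

theorem Continuous.orbitSum {u : Y → ℂ} (hu : Continuous u) : Continuous (orbitSum h q u) :=
  continuous_finsetSum _ fun i _ => hu.comp (h ^ i).continuous

end Cyclic

/-! ### Removing zeros in a wandering disc -/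

section Cutoff

variable {Y : Type*} {e : Y → ℂ}

/-- A cutoff function which is one on the disc of radius `r` and vanishes off the disc of radius
`2 * r`. -/
noncomputable def discCutoff (e : Y → ℂ) (a : ℂ) (r : ℝ) (y : Y) : ℝ :=
  max 0 (min 1 (2 - dist (e y) a / r))

theorem discCutoff_nonneg (a : ℂ) (r : ℝ) (y : Y) : 0 ≤ discCutoff e a r y := le_max_left _ _

theorem discCutoff_le_one (a : ℂ) (r : ℝ) (y : Y) : discCutoff e a r y ≤ 1 :=
  max_le zero_le_one (min_le_left _ _)

theorem discCutoff_eq_one {a : ℂ} {r : ℝ} (hr : 0 < r) {y : Y} (hy : dist (e y) a ≤ r) :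
    discCutoff e a r y = 1 := by
  have : dist (e y) a / r ≤ 1 := (div_le_one hr).2 hy
  rw [discCutoff, min_eq_left (by linarith), max_eq_right zero_le_one]

theorem discCutoff_eq_zero {a : ℂ} {r : ℝ} (hr : 0 < r) {y : Y} (hy : 2 * r ≤ dist (e y) a) :
    discCutoff e a r y = 0 := by
  have : 2 ≤ dist (e y) a / r := (le_div_iff₀ hr).2 hy
  exact max_eq_left ((min_le_right _ _).trans (by linarith))

end Cutoff

section DiscStep

variable {Y : Type*} [TopologicalSpace Y] {h : Y ≃ₜ Y} {q : ℕ} {e : Y → ℂ}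

theorem Continuous.discCutoff (he : Continuous e) (a : ℂ) (r : ℝ) :
    Continuous (discCutoff e a r) := by
  unfold _root_.discCutoff
  fun_prop

/-- The later iterates of a point of `T` leave `T`, where `κ` vanishes, so only the term of index
zero survives. Symmetrizing a correction therefore does not change it on the disc. -/
theorem orbitSum_eq_of_wandering (hq : 0 < q) {T : Set Y} {κ : Y → ℂ} (hκ : ∀ y ∉ T, κ y = 0)
    (hT : ∀ y ∈ T, ∀ i, 0 < i → i < q → (h ^ i) y ∉ T) {y : Y} (hy : y ∈ T) :
    orbitSum h q κ y = κ y := by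
  rw [orbitSum, Finset.sum_eq_single_of_mem 0 (by simpa using hq)]
  · simp
  · intro i hi hi0
    exact hκ _ (hT y hy i (Nat.pos_of_ne_zero hi0) (Finset.mem_range.1 hi))

theorem norm_orbitSum_lt (hq : 0 < q) {κ : Y → ℂ} {ε : ℝ} (hκ : ∀ y, ‖κ y‖ < ε) (y : Y) :
    ‖orbitSum h q κ y‖ < q * ε := by
  refine (norm_sum_le _ _).trans_lt ?_
  calc ∑ i ∈ Finset.range q, ‖κ ((h ^ i) y)‖ < ∑ _i ∈ Finset.range q, ε :=
        Finset.sum_lt_sum_of_nonempty (by simpa using hq.ne') fun i _ => hκ _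
    _ = q * ε := by simp

theorem orbitSum_eq_zero {T : Set Y} {κ : Y → ℂ} (hκ : ∀ y ∉ T, κ y = 0) {y : Y}
    (hy : y ∉ cycleSaturation h q T) : orbitSum h q κ y = 0 :=
  Finset.sum_eq_zero fun i hi => hκ _ fun hm => hy ⟨i, Finset.mem_range.1 hi, hm⟩

/-- An invariant function can be perturbed near the translates of a circle so as to have no zeros
on the circle. -/
theorem exists_invariant_perturbation (hq : h ^ q = 1) (hq0 : 0 < q) (he : IsOpenEmbedding e)
    {c : Y} {r : ℝ} (hr : 0 < r) (hball : Metric.closedBall (e c) (2 * r) ⊆ range e)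
    (hdisj : ∀ y ∈ e ⁻¹' Metric.closedBall (e c) (2 * r), ∀ i, 0 < i → i < q →
      (h ^ i) y ∉ e ⁻¹' Metric.closedBall (e c) (2 * r))
    {v : Y → ℂ} (hv : Continuous v) (hinv : ∀ y, v (h y) = v y) {ε : ℝ} (hε : 0 < ε) :
    ∃ u : Y → ℂ, Continuous u ∧ (∀ y, u (h y) = u y) ∧ (∀ y, ‖u y - v y‖ < ε) ∧
      (∀ y ∉ cycleSaturation h q (e ⁻¹' Metric.closedBall (e c) (2 * r)), u y = v y) ∧
      ∀ y, e y ∈ Metric.sphere (e c) r → u y ≠ 0 := by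
  have hqR : (0 : ℝ) < q := by exact_mod_cast hq0
  -- The bound is `ε / q` because symmetrization adds `q` terms.
  obtain ⟨w, hw, hwv, hw0⟩ := he.exists_approx_ne_zero_on_circle (r := r) hball hv (div_pos hε hqR)
  set κ : Y → ℂ := fun y => discCutoff e (e c) r y * (w y - v y) with hκ
  have hκc : Continuous κ :=
    (Complex.continuous_ofReal.comp (he.continuous.discCutoff _ _)).mul (hw.sub hv)
  have hκ0 : ∀ y ∉ e ⁻¹' Metric.closedBall (e c) (2 * r), κ y = 0 := by
    intro y hy
    have : 2 * r < dist (e y) (e c) := by simpa using hy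
    simp [hκ, discCutoff_eq_zero hr this.le]
  have hκε : ∀ y, ‖κ y‖ < ε / q := by
    intro y
    by_cases hy : y ∈ e ⁻¹' Metric.closedBall (e c) (2 * r)
    · calc ‖κ y‖ ≤ 1 * ‖w y - v y‖ := by
            rw [hκ, norm_mul, Complex.norm_real, Real.norm_of_nonneg (discCutoff_nonneg _ _ _)]
            exact mul_le_mul_of_nonneg_right (discCutoff_le_one _ _ _) (norm_nonneg _)
        _ < ε / q := by rw [one_mul, ← dist_eq_norm]; exact hwv y hy
    · rw [hκ0 y hy, norm_zero]
      positivity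
  refine ⟨fun y => v y + orbitSum h q κ y, hv.add hκc.orbitSum, fun y => ?_, fun y => ?_,
    fun y hy => ?_, fun y hy => ?_⟩
  · simp only [hinv, orbitSum_apply hq]
  · rw [add_sub_cancel_left]
    refine (norm_orbitSum_lt hq0 hκε y).trans_eq ?_
    field_simp
  · simp only [orbitSum_eq_zero hκ0 hy, add_zero]
  · have hyT : y ∈ e ⁻¹' Metric.closedBall (e c) (2 * r) := by
      have : dist (e y) (e c) = r := hy
      simp only [mem_preimage, Metric.mem_closedBall]
      linarith
    simp only [orbitSum_eq_of_wandering hq0 hκ0 hdisj hyT]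
    have : discCutoff e (e c) r y = 1 := discCutoff_eq_one hr (le_of_eq hy)
    simpa [hκ, this] using hw0 y hy

theorem orbitProd_ne_zero (he : Function.Injective e) {c y : Y}
    (hy : y ∉ cycleSaturation h q {c}) : orbitProd h q e c y ≠ 0 :=
  Finset.prod_ne_zero_iff.2 fun i hi h0 =>
    hy ⟨i, Finset.mem_range.1 hi, he (sub_eq_zero.1 h0)⟩

/-- An invariant function without zeros on the boundary of a disc can be replaced on the translates
of the disc by a function without zeros, after multiplication by a power of the orbit product. -/
theorem exists_invariant_replacement (hq : h ^ q = 1) (hq0 : 0 < q) (he : IsOpenEmbedding e)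
    {c : Y} {r : ℝ} (hr : 0 < r) (hball : Metric.closedBall (e c) (2 * r) ⊆ range e)
    (hdisj : ∀ y ∈ e ⁻¹' Metric.closedBall (e c) (2 * r), ∀ i, 0 < i → i < q →
      (h ^ i) y ∉ e ⁻¹' Metric.closedBall (e c) (2 * r))
    {v : Y → ℂ} (hv : Continuous v) (hinv : ∀ y, v (h y) = v y)
    (hv0 : ∀ y, e y ∈ Metric.sphere (e c) r → v y ≠ 0) :
    ∃ (u : Y → ℂ) (d : ℤ), Continuous u ∧ (∀ y, u (h y) = u y) ∧
      (∀ y ∈ cycleSaturation h q (e ⁻¹' Metric.closedBall (e c) r), u y ≠ 0) ∧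
      (∀ y ∉ cycleSaturation h q (e ⁻¹' Metric.closedBall (e c) r), u y = v y * orbitProd h q e c y ^ d) := by
  set T := e ⁻¹' Metric.closedBall (e c) (2 * r) with hT
  set B := e ⁻¹' Metric.closedBall (e c) r with hB
  have hBT : B ⊆ T := preimage_mono (Metric.closedBall_subset_closedBall (by linarith))
  have hballr : Metric.closedBall (e c) r ⊆ range e :=
    (Metric.closedBall_subset_closedBall (by linarith)).trans hball
  have hcB : c ∈ B := by simp [hB, hr.le]
  obtain ⟨d, G₁, hG₁, hvG₁⟩ := he.exists_zpow_log_on_circle hr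
    (Metric.sphere_subset_closedBall.trans hballr) hv.continuousOn hv0
  let γ : Y → ℂ := fun y => ∏ i ∈ Finset.range (q - 1), (e ((h ^ (i + 1)) y) - e c)
  have hγ : ∀ y, orbitProd h q e c y = (e y - e c) * γ y := by
    intro y
    obtain ⟨n, rfl⟩ := Nat.exists_eq_succ_of_ne_zero hq0.ne'
    simp only [orbitProd, γ, Nat.succ_eq_add_one, Finset.prod_range_succ', mul_comm,
      Nat.add_sub_cancel]
    simp
  have hγc : Continuous γ :=
    continuous_finsetProd _ fun i _ => (he.continuous.comp (h ^ (i + 1)).continuous).sub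
      continuous_const
  -- The factors of the orbit product other than the first vanish only where a proper iterate hits
  -- `c`, which does not happen in the wandering disc.
  obtain ⟨G₂, hG₂, hγG₂⟩ := he.exists_log_on_disc hr.le hballr hγc.continuousOn (by
    intro y hy
    refine Finset.prod_ne_zero_iff.2 fun i hi h0 => ?_
    have := he.injective (sub_eq_zero.1 h0)
    exact hdisj y (hBT hy) (i + 1) (by lia) (by simp at hi; lia) (this ▸ hBT hcB))
  set κ : Y → ℂ := fun y => discCutoff e (e c) r y * (G₁ y - d * G₂ y) with hκ
  have hκc : Continuous κ :=
    (Complex.continuous_ofReal.comp (he.continuous.discCutoff _ _)).mul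
      (hG₁.sub (continuous_const.mul hG₂))
  have hκ0 : ∀ y ∉ T, κ y = 0 := by
    intro y hy
    have : 2 * r < dist (e y) (e c) := by simpa [hT] using hy
    simp [hκ, discCutoff_eq_zero hr this.le]
  -- On the circle the powers of `e y - e c` in `v` and in the orbit product cancel, leaving an
  -- exponential. It extends without zeros over the disc, and invariance carries the matching to all
  -- translates.
  have hkey : ∀ y, e y ∈ Metric.sphere (e c) r →
      Complex.exp (orbitSum h q κ y) = v y * orbitProd h q e c y ^ (-d) := by
    intro y hy
    have hyB : y ∈ B := Metric.sphere_subset_closedBall hy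
    have hne : e y - e c ≠ 0 := by
      rw [← norm_pos_iff, ← dist_eq_norm, Metric.mem_sphere.1 hy]; exact hr
    rw [orbitSum_eq_of_wandering hq0 hκ0 hdisj (hBT hyB), hκ, hγ, hvG₁ y hy, hγG₂ y hyB]
    simp only [discCutoff_eq_one hr (Metric.mem_sphere.1 hy).le, Complex.ofReal_one, one_mul]
    rw [mul_zpow, ← Complex.exp_int_mul, sub_eq_add_neg, Complex.exp_add, mul_mul_mul_comm,
      ← zpow_add₀ hne]
    simp
  set O := cycleSaturation h q B with hO
  have hOcl : IsClosed O := (Metric.isClosed_closedBall.preimage he.continuous).cycleSaturation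
  have hOint : cycleSaturation h q (e ⁻¹' Metric.ball (e c) r) ⊆ interior O :=
    interior_maximal (cycleSaturation_mono (preimage_mono Metric.ball_subset_closedBall))
      (Metric.isOpen_ball.preimage he.continuous).cycleSaturation
  have hvi := fun i y => apply_pow_eq_of_invariant hinv i y
  have hbi := fun i y => apply_pow_eq_of_invariant (orbitProd_apply hq e c) i y
  have hsi := fun i y => apply_pow_eq_of_invariant (orbitSum_apply hq κ) i y
  classical
  refine ⟨O.piecewise (fun y => Complex.exp (orbitSum h q κ y))
    (fun y => v y * orbitProd h q e c y ^ (-d)), -d, ?_, fun y => ?_, fun y hy => ?_,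
    fun y hy => by simp [hy]⟩
  · refine continuous_piecewise (fun y hy => ?_) (by
      exact (Complex.continuous_exp.comp hκc.orbitSum).continuousOn) ?_
    · obtain ⟨i, hi, hyi⟩ := hOcl.frontier_subset hy
      have hsph : e ((h ^ i) y) ∈ Metric.sphere (e c) r := by
        refine le_antisymm hyi (not_lt.1 fun hlt => hy.2 (hOint ⟨i, hi, hlt⟩))
      rw [← hsi i y, ← hvi i y, ← hbi i y]
      exact hkey _ hsph
    · refine hv.continuousOn.mul ((he.continuous.orbitProd c).continuousOn.zpow₀ _ fun y hy => ?_)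
      left
      refine orbitProd_ne_zero he.injective fun hc => ?_
      rw [closure_compl] at hy
      exact hy (hOint (cycleSaturation_mono (by simpa using hr) hc))
  · have := mem_cycleSaturation_apply_iff hq (B := B) (y := y)
    by_cases hy : y ∈ O
    · rw [piecewise_eq_of_mem _ _ _ hy, piecewise_eq_of_mem _ _ _ (this.2 hy), orbitSum_apply hq]
    · rw [piecewise_eq_of_notMem _ _ _ hy, piecewise_eq_of_notMem _ _ _ (fun h => hy (this.1 h)),
        orbitProd_apply hq, hinv]
  · rw [piecewise_eq_of_mem _ _ _ hy]
    exact Complex.exp_ne_zero _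

/-- Perturb to make the circle free of zeros, then replace the function inside the disc. The
remaining zeros in `D` lie in `V`, and off the larger saturated disc only a power of the orbit
product is introduced. -/
theorem exists_invariant_clearing_disc (hq : h ^ q = 1) (hq0 : 0 < q) (he : IsOpenEmbedding e)
    {c : Y} {r : ℝ} (hr : 0 < r) (hball : Metric.closedBall (e c) (2 * r) ⊆ range e)
    (hdisj : ∀ y ∈ e ⁻¹' Metric.closedBall (e c) (2 * r), ∀ i, 0 < i → i < q →
      (h ^ i) y ∉ e ⁻¹' Metric.closedBall (e c) (2 * r))
    {v : Y → ℂ} (hv : Continuous v) (hinv : ∀ y, v (h y) = v y) {D V : Set Y} (hD : IsCompact D)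
    (hV : IsOpen V) (hz : ∀ y ∈ D, v y = 0 →
      y ∈ V ∨ y ∈ cycleSaturation h q (e ⁻¹' Metric.ball (e c) r)) :
    ∃ (u : Y → ℂ) (d : ℤ), Continuous u ∧ (∀ y, u (h y) = u y) ∧ (∀ y ∈ D, u y = 0 → y ∈ V) ∧
      (∀ y ∉ cycleSaturation h q (e ⁻¹' Metric.closedBall (e c) (2 * r)),
        u y = v y * orbitProd h q e c y ^ d) := by
  set O := cycleSaturation h q (e ⁻¹' Metric.ball (e c) r) with hO
  have hOo : IsOpen O := (Metric.isOpen_ball.preimage he.continuous).cycleSaturation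
  -- A perturbation smaller than this compactness bound creates no zeros in `D` outside `V ∪ O`.
  obtain ⟨m, hm, hmv⟩ : ∃ m > 0, ∀ y ∈ D \ (V ∪ O), m ≤ ‖v y‖ := by
    rcases (D \ (V ∪ O)).eq_empty_or_nonempty with h0 | hne
    · exact ⟨1, one_pos, by simp [h0]⟩
    · obtain ⟨y, hy, hmin⟩ := (hD.diff (hV.union hOo)).exists_isMinOn hne hv.norm.continuousOn
      exact ⟨‖v y‖, norm_pos_iff.2 fun h0 => hy.2 (hz y hy.1 h0), fun z hz => hmin hz⟩
  obtain ⟨w, hw, hwinv, hwv, hweq, hw0⟩ :=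
    exists_invariant_perturbation hq hq0 he hr hball hdisj hv hinv hm
  obtain ⟨u, d, hu, huinv, hu0, hueq⟩ :=
    exists_invariant_replacement hq hq0 he hr hball hdisj hw hwinv hw0
  have hsub : cycleSaturation h q (e ⁻¹' Metric.closedBall (e c) r) ⊆
      cycleSaturation h q (e ⁻¹' Metric.closedBall (e c) (2 * r)) :=
    cycleSaturation_mono (preimage_mono (Metric.closedBall_subset_closedBall (by linarith)))
  refine ⟨u, d, hu, huinv, fun y hy huy => ?_, fun y hy => ?_⟩
  · have hyn : y ∉ cycleSaturation h q (e ⁻¹' Metric.closedBall (e c) r) := fun h => hu0 y h huy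
    have hyO : y ∉ O :=
      fun h => hyn (cycleSaturation_mono (preimage_mono Metric.ball_subset_closedBall) h)
    rw [hueq y hyn] at huy
    have hwy : w y = 0 := by
      refine (mul_eq_zero.1 huy).resolve_right (zpow_ne_zero _ (orbitProd_ne_zero he.injective ?_))
      exact fun h => hyn (cycleSaturation_mono (by simpa using hr.le) h)
    by_contra hyV
    have h1 := hmv y ⟨hy, by simp [hyV, hyO]⟩
    have h2 := hwv y
    rw [hwy, zero_sub, norm_neg] at h2
    linarith
  · rw [hueq y fun h => hy (hsub h), hweq y hy]

end DiscStep

theorem Homeomorph.coe_pow_eq_iterate {Y : Type*} [TopologicalSpace Y] (h : Y ≃ₜ Y) (i : ℕ) :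
    ⇑(h ^ i) = h^[i] := by
  induction i with
  | zero => ext; simp
  | succ i ih =>
    ext y
    rw [pow_succ, Homeomorph.mul_apply, ih, Function.iterate_succ_apply]

/-! ### Zeros on free orbits and the degree contradiction -/

section FreeZeros

variable {Y : Type*} [TopologicalSpace Y] {h : Y ≃ₜ Y} {q : ℕ} {e : Y → ℂ}

/-- Separate `y` from each of its finitely many proper iterates and intersect the resulting
neighbourhoods. -/
theorem exists_wandering_disc (he : IsOpenEmbedding e) {W : Set Y} (hW : IsOpen W) {y : Y}
    (hy : y ∈ W) (hfree : ∀ i, 0 < i → i < q → (h ^ i) y ≠ y) :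
    ∃ r > 0, Metric.closedBall (e y) (2 * r) ⊆ range e ∧
      e ⁻¹' Metric.closedBall (e y) (2 * r) ⊆ W ∧
      ∀ z ∈ e ⁻¹' Metric.closedBall (e y) (2 * r), ∀ i, 0 < i → i < q →
        (h ^ i) z ∉ e ⁻¹' Metric.closedBall (e y) (2 * r) := by
  have : T2Space Y := he.isEmbedding.t2Space
  have hN : ∀ i ∈ Finset.Ioo 0 q, ∃ N ∈ 𝓝 y, ∀ z ∈ N, (h ^ i) z ∉ N := by
    intro i hi
    obtain ⟨h0, h1⟩ := Finset.mem_Ioo.1 hi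
    obtain ⟨U, V, hU, hV, hyU, hyV, hUV⟩ := t2_separation (hfree i h0 h1).symm
    refine ⟨U ∩ (h ^ i) ⁻¹' V, Filter.inter_mem (hU.mem_nhds hyU)
      ((hV.preimage (h ^ i).continuous).mem_nhds hyV), fun z hz hz' => ?_⟩
    exact disjoint_left.1 hUV hz'.1 hz.2
  choose! N hN hNd using hN
  have hM : W ∩ ⋂ i ∈ Finset.Ioo 0 q, N i ∈ 𝓝 y :=
    Filter.inter_mem (hW.mem_nhds hy) ((Filter.biInter_finset_mem _).2 hN)
  obtain ⟨δ, hδ, hball⟩ := Metric.nhds_basis_closedBall.mem_iff.1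
    (he.isOpenMap.image_mem_nhds hM)
  have hsub : e ⁻¹' Metric.closedBall (e y) δ ⊆ W ∩ ⋂ i ∈ Finset.Ioo 0 q, N i := by
    intro z hz
    obtain ⟨x, hx, hxz⟩ := hball hz
    rwa [← he.injective hxz]
  refine ⟨δ / 2, half_pos hδ, ?_⟩
  rw [mul_div_cancel₀ δ two_ne_zero]
  refine ⟨hball.trans (image_subset_range _ _), hsub.trans inter_subset_left,
    fun z hz i h0 h1 hz' => ?_⟩
  have hi : i ∈ Finset.Ioo 0 q := Finset.mem_Ioo.2 ⟨h0, h1⟩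
  exact hNd i hi z (mem_iInter₂.1 (hsub hz).2 i hi) (mem_iInter₂.1 (hsub hz').2 i hi)

/-- The class on `S` of an invariant function with free zeros in `D` is a power of the common class
of the orbit products. -/
theorem exists_logEquivOn_zpow_of_free_zeros (hq : h ^ q = 1) (hq0 : 0 < q)
    (he : IsOpenEmbedding e) {D S W W₁ : Set Y} (hD : IsCompact D) (hW : IsOpen W)
    (hWinv : ∀ y, h y ∈ W ↔ y ∈ W) (hSW : Disjoint S W) (hW₁ : W₁ ⊆ W)
    (hlog : ∀ u : Y → ℂ, Continuous u → (∀ y ∈ D, u y ≠ 0) → LogEquivOn S u fun _ => 1)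
    {τ : Y → ℂ} (hβ : ∀ c ∈ W₁, LogEquivOn S (orbitProd h q e c) τ)
    {v : Y → ℂ} (hv : Continuous v) (hinv : ∀ y, v (h y) = v y)
    (hz : ∀ y ∈ D, v y = 0 → y ∈ W₁ ∧ ∀ i, 0 < i → i < q → (h ^ i) y ≠ y) :
    ∃ k : ℤ, LogEquivOn S v fun y => τ y ^ k := by
  have hWsat : cycleSaturation h q W ⊆ W := by
    rintro y ⟨i, -, hi⟩
    exact (apply_pow_eq_of_invariant (v := fun y => y ∈ W) (fun y => propext (hWinv y)) i y).mp hi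
  -- Induction over a finite cover of the zeros by wandering discs: clearing one disc changes the
  -- class on `S` by a power of `τ`, and a function without zeros in `D` has trivial class.
  have key : ∀ s : Finset (Y × ℝ), (∀ p ∈ s, p.1 ∈ W₁ ∧ 0 < p.2 ∧
      Metric.closedBall (e p.1) (2 * p.2) ⊆ range e ∧
      e ⁻¹' Metric.closedBall (e p.1) (2 * p.2) ⊆ W ∧
      ∀ z ∈ e ⁻¹' Metric.closedBall (e p.1) (2 * p.2), ∀ i, 0 < i → i < q →
        (h ^ i) z ∉ e ⁻¹' Metric.closedBall (e p.1) (2 * p.2)) →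
      ∀ v : Y → ℂ, Continuous v → (∀ y, v (h y) = v y) →
      (∀ y ∈ D, v y = 0 → ∃ p ∈ s, y ∈ cycleSaturation h q (e ⁻¹' Metric.ball (e p.1) p.2)) →
      ∃ k : ℤ, LogEquivOn S v fun y => τ y ^ k := by
    classical
    intro s
    induction s using Finset.induction_on with
    | empty =>
      intro _ v hv _ hz
      exact ⟨0, by simpa using hlog v hv fun y hy h0 => by simpa using hz y hy h0⟩
    | insert p s _ ih =>
      intro hs v hv hinv hz
      obtain ⟨hpW₁, hr, hball, hTW, hdisj⟩ := hs p (by simp)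
      obtain ⟨u, d, hu, huinv, huz, hueq⟩ := exists_invariant_clearing_disc hq hq0 he hr hball hdisj
        hv hinv hD (V := ⋃ p ∈ s, cycleSaturation h q (e ⁻¹' Metric.ball (e p.1) p.2))
        (isOpen_biUnion fun p _ => (Metric.isOpen_ball.preimage he.continuous).cycleSaturation)
        (fun y hy h0 => by
          obtain ⟨p', hp', hy'⟩ := hz y hy h0
          rcases Finset.mem_insert.1 hp' with rfl | hp'
          · exact .inr hy'
          · exact .inl (mem_iUnion₂.2 ⟨p', hp', hy'⟩))
      obtain ⟨k, hk⟩ := ih (fun p' hp' => hs p' (Finset.mem_insert_of_mem hp')) u hu huinv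
        fun y hy h0 => by simpa using huz y hy h0
      have hβp := hβ p.1 hpW₁
      have hSout : ∀ y ∈ S, y ∉ cycleSaturation h q (e ⁻¹' Metric.closedBall (e p.1) (2 * p.2)) :=
        fun y hy hyT => disjoint_left.1 hSW hy (hWsat (cycleSaturation_mono hTW hyT))
      have hβ0 : ∀ y ∈ S, orbitProd h q e p.1 y ≠ 0 := fun y hy =>
        orbitProd_ne_zero he.injective fun hc => hSout y hy
          (cycleSaturation_mono (by simpa using hr.le) hc)
      have hτ0 : ∀ y ∈ S, τ y ≠ 0 := by
        obtain ⟨g, -, hg⟩ := hβp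
        intro y hy h0
        exact hβ0 y hy (by rw [hg y hy, h0, zero_mul])
      obtain ⟨g, hg, hgeq⟩ := hk.mul (hβp.zpow (-d))
      refine ⟨k + -d, g, hg, fun y hy => ?_⟩
      have hgy := hgeq y hy
      simp only [← zpow_add₀ (hτ0 y hy)] at hgy
      rw [← hgy, hueq y (hSout y hy), mul_assoc,
        ← zpow_add₀ (hβ0 y hy)]
      simp
  set Z := D ∩ v ⁻¹' {0} with hZ
  have hZc : IsCompact Z := hD.inter_right (isClosed_singleton.preimage hv)
  have hdisc : ∀ y ∈ Z, ∃ r > 0, Metric.closedBall (e y) (2 * r) ⊆ range e ∧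
      e ⁻¹' Metric.closedBall (e y) (2 * r) ⊆ W ∧
      ∀ z ∈ e ⁻¹' Metric.closedBall (e y) (2 * r), ∀ i, 0 < i → i < q →
        (h ^ i) z ∉ e ⁻¹' Metric.closedBall (e y) (2 * r) := by
    rintro y ⟨hyD, hy0⟩
    exact exists_wandering_disc he hW (hW₁ (hz y hyD hy0).1) (hz y hyD hy0).2
  choose! r hr hdisc using hdisc
  obtain ⟨t, htZ, ht⟩ := hZc.elim_nhds_subcover (fun y => e ⁻¹' Metric.ball (e y) (r y))
    fun y hy => (Metric.isOpen_ball.preimage he.continuous).mem_nhds (by simpa using hr y hy)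
  classical
  refine key (t.image fun y => (y, r y)) ?_ v hv hinv fun y hy h0 => ?_
  · intro p hp
    obtain ⟨y, hyt, rfl⟩ := Finset.mem_image.1 hp
    exact ⟨(hz y (htZ y hyt).1 (htZ y hyt).2).1, hr y (htZ y hyt), hdisc y (htZ y hyt)⟩
  · obtain ⟨x, hx, hyx⟩ := mem_iUnion₂.1 (ht ⟨hy, h0⟩)
    exact ⟨(x, r x), Finset.mem_image_of_mem _ hx, subset_cycleSaturation hq0 _ hyx⟩

/-- A function on a disc which vanishes only at `p`, and which is the coordinate near `p`, has the
class of the coordinate on the boundary. -/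
theorem logEquivOn_coordinate_of_eventuallyEq (he : IsOpenEmbedding e) {a : ℂ} {r : ℝ} (hr : 0 ≤ r)
    (hball : Metric.closedBall a r ⊆ range e) {p : Y} {F : Y → ℂ} (hF : Continuous F)
    (hFp : ∀ᶠ y in 𝓝 p, F y = e y - e p)
    (hF0 : ∀ y ∈ e ⁻¹' Metric.closedBall a r, y ≠ p → F y ≠ 0) (hp : e p ∉ Metric.sphere a r) :
    LogEquivOn (e ⁻¹' Metric.sphere a r) F fun y => e y - e p := by
  classical
  have : T2Space Y := he.isEmbedding.t2Space
  have hne : ∀ y, y ≠ p → e y - e p ≠ 0 := fun y hy h0 => hy (he.injective (sub_eq_zero.1 h0))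
  -- Dividing out the only zero leaves a nonvanishing function on the disc, which has a logarithm
  -- there.
  let u : Y → ℂ := fun y => if y = p then 1 else F y / (e y - e p)
  have hu : Continuous u := by
    rw [continuous_iff_continuousAt]
    intro y
    by_cases hy : y = p
    · subst hy
      have : u =ᶠ[𝓝 y] fun _ => 1 := by
        filter_upwards [hFp] with z hz
        by_cases hzy : z = y
        · simp [u, hzy]
        · simp only [u, if_neg hzy, hz, div_self (hne z hzy)]
      exact continuousAt_const.congr this.symm
    · have : u =ᶠ[𝓝 y] fun z => F z / (e z - e p) := by
        filter_upwards [isOpen_ne.mem_nhds hy] with z hz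
        exact if_neg hz
      exact (hF.continuousAt.div (he.continuous.continuousAt.sub continuousAt_const)
        (hne y hy)).congr this.symm
  obtain ⟨G, hG, hGu⟩ := he.exists_log_on_disc hr hball hu.continuousOn (by
    intro y hy
    by_cases hyp : y = p
    · simp [u, hyp]
    · simpa only [u, if_neg hyp] using div_ne_zero (hF0 y hy hyp) (hne y hyp))
  refine ⟨G, hG.continuousOn, fun y hy => ?_⟩
  have hyp : y ≠ p := by rintro rfl; exact hp hy
  have hGy := hGu y (Metric.sphere_subset_closedBall hy)
  simp only [u, if_neg hyp] at hGy
  rw [← hGy, mul_div_cancel₀ _ (hne y hyp)]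

/-- A period `i` prime to `q`, together with the period `q`, would give the period one. -/
theorem pow_apply_ne_of_prime (hq : q.Prime) (hh : h ^ q = 1) {y : Y} (hy : h y ≠ y) {i : ℕ}
    (hi0 : 0 < i) (hiq : i < q) : (h ^ i) y ≠ y := by
  intro hi
  have h1 : Function.IsPeriodicPt h i y := by
    rw [Function.IsPeriodicPt, ← h.coe_pow_eq_iterate]; exact hi
  have h2 : Function.IsPeriodicPt h q y := by
    rw [Function.IsPeriodicPt, ← h.coe_pow_eq_iterate, hh]; rfl
  have h3 := h1.gcd h2
  rw [Nat.gcd_comm, (Nat.coprime_of_lt_prime hi0.ne' hiq hq).gcd_eq_one] at h3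
  exact hy h3

/-- The degree contradiction behind Newman's theorem: the average of `e` over cycles takes nearby
values once at a fixed point outside the disc, but along whole free cycles at a moved point. -/
theorem false_of_fixed_outside_disc (hq : q.Prime) (hh : h ^ q = 1) (he : IsOpenEmbedding e)
    {R : ℝ} (hR : 0 < R) {a : Y} (ha : ‖e a‖ = R) (hfix : ∀ y, R ≤ ‖e y‖ → h y = y)
    (hcl : a ∈ closure {y | h y ≠ y}) : False := by
  have hq0 := hq.pos
  have hqC : (q : ℂ) ≠ 0 := by exact_mod_cast hq0.ne'
  have hfixpow : ∀ y, h y = y → ∀ i : ℕ, (h ^ i) y = y := fun y hy i => by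
    rw [h.coe_pow_eq_iterate]
    exact Function.iterate_fixed hy i
  set A : Y → ℂ := fun y => orbitSum h q e y / q with hA
  have hAc : Continuous A := he.continuous.orbitSum.div_const _
  have hAinv : ∀ y, A (h y) = A y := fun y => by simp only [hA, orbitSum_apply hh]
  have hAfix : ∀ y, h y = y → A y = e y := by
    intro y hy
    simp [hA, orbitSum, hfixpow y hy, hqC]
  -- The whole cycle of a moved point is moved, so it lies in the open disc of radius `R`, and so
  -- does its average.
  have hAlt : ∀ y, h y ≠ y → ‖A y‖ < R := by
    intro y hy
    have hlt : ∀ i : ℕ, ‖e ((h ^ i) y)‖ < R := by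
      intro i
      by_contra hle
      have := hfix _ (not_lt.1 hle)
      rw [← Homeomorph.mul_apply, ← pow_succ', pow_succ, Homeomorph.mul_apply] at this
      exact hy ((h ^ i).injective this)
    have : ‖orbitSum h q e y‖ < q * R := by
      refine (norm_sum_le _ _).trans_lt ?_
      calc ∑ i ∈ Finset.range q, ‖e ((h ^ i) y)‖ < ∑ _i ∈ Finset.range q, R :=
            Finset.sum_lt_sum_of_nonempty (by simpa using hq0.ne') fun i _ => hlt i
        _ = q * R := by simp
    rw [hA, norm_div, Complex.norm_natCast, div_lt_iff₀ (by exact_mod_cast hq0)]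
    linarith
  have hAa : ∀ y, A y = e a → y = a := by
    intro y hy
    by_cases hy' : h y = y
    · exact he.injective (by rw [← hAfix y hy', hy])
    · have := hAlt y hy'
      rw [hy, ha] at this
      exact (lt_irrefl _ this).elim
  obtain ⟨r, hr, hball⟩ := Metric.nhds_basis_closedBall.mem_iff.1
    (he.isOpen_range.mem_nhds (mem_range_self a))
  set D := e ⁻¹' Metric.closedBall (e a) r with hD
  set S := e ⁻¹' Metric.sphere (e a) r with hS
  have hDc : IsCompact D :=
    he.isCompact_preimage_of_subset_range (isCompact_closedBall _ _) hball
  -- The points whose full cycle stays in the ball: an invariant open neighbourhood of `a` inside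
  -- it.
  set W := (cycleSaturation h q (e ⁻¹' Metric.ball (e a) r)ᶜ)ᶜ with hW
  have hWo : IsOpen W :=
    (Metric.isOpen_ball.preimage he.continuous).isClosed_compl.cycleSaturation.isOpen_compl
  have hWinv : ∀ y, h y ∈ W ↔ y ∈ W := fun y => not_congr (mem_cycleSaturation_apply_iff hh)
  have hWball : W ⊆ e ⁻¹' Metric.ball (e a) r := by
    intro y hy
    by_contra hn
    exact hy (subset_cycleSaturation hq0 _ hn)
  have hSW : Disjoint S W := disjoint_left.2 fun y hy hyW => by
    have h1 : dist (e y) (e a) = r := hy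
    have h2 : dist (e y) (e a) < r := hWball hyW
    linarith
  have haW : a ∈ W := by
    rintro ⟨i, -, hi⟩
    rw [hfixpow a (hfix a ha.ge)] at hi
    exact hi (by simpa using hr)
  obtain ⟨r₁, hr₁, hr₁W⟩ := Metric.isOpen_iff.1 (he.isOpenMap _ hWo) _ (mem_image_of_mem e haW)
  set W₁ := e ⁻¹' Metric.ball (e a) r₁ with hW₁
  have hW₁W : W₁ ⊆ W := by
    intro y hy
    obtain ⟨z, hz, hzy⟩ := hr₁W hy
    rwa [← he.injective hzy]
  obtain ⟨η, hη, hηr, hηA⟩ : ∃ η > 0, η ≤ r₁ ∧ ∀ y ∈ D \ W₁, η ≤ ‖A y - e a‖ := by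
    rcases (D \ W₁).eq_empty_or_nonempty with h0 | hne
    · exact ⟨r₁, hr₁, le_rfl, by simp [h0]⟩
    · obtain ⟨y, hy, hmin⟩ := (hDc.diff (Metric.isOpen_ball.preimage he.continuous)).exists_isMinOn
        hne (hAc.sub continuous_const).norm.continuousOn
      have hpos : 0 < ‖A y - e a‖ := norm_pos_iff.2 fun h0 => hy.2 (by
        rw [hAa y (sub_eq_zero.1 h0)]; simpa [hW₁] using hr₁)
      exact ⟨min r₁ ‖A y - e a‖, lt_min hr₁ hpos, min_le_left _ _,
        fun z hz => (min_le_right _ _).trans (hmin hz)⟩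
  have hSD : S ⊆ D \ W₁ := fun y hy => ⟨Metric.sphere_subset_closedBall hy,
    fun h1 => disjoint_left.1 hSW hy (hW₁W h1)⟩
  obtain ⟨p₁, hp₁η, hp₁⟩ := mem_closure_iff_nhds.1 hcl (e ⁻¹' Metric.ball (e a) η)
    ((Metric.isOpen_ball.preimage he.continuous).mem_nhds (by simpa using hη))
  -- Pushing `e a` radially outward by `η / 2` leaves the disc of radius `R`, so this value belongs
  -- to a fixed point `p₀` with fixed neighbourhood.
  have hz₀ : (1 + η / (2 * R) : ℝ) * e a ∈ Metric.ball (e a) η := by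
    rw [Metric.mem_ball, dist_eq_norm]
    have : ((1 + η / (2 * R) : ℝ) : ℂ) * e a - e a = ((η / (2 * R) : ℝ) : ℂ) * e a := by
      push_cast; ring
    rw [this, norm_mul, ha, Complex.norm_real, Real.norm_of_nonneg (by positivity)]
    field_simp
    linarith
  obtain ⟨p₀, hp₀W, hp₀⟩ := hr₁W (Metric.ball_subset_ball hηr hz₀)
  rw [← hp₀] at hz₀
  have hp₀R : R < ‖e p₀‖ := by
    rw [hp₀, norm_mul, ha, Complex.norm_real, Real.norm_of_nonneg (by positivity)]
    have : 0 < η / (2 * R) := by positivity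
    nlinarith
  have hfix₀ : ∀ᶠ y in 𝓝 p₀, h y = y := by
    filter_upwards [(isOpen_lt continuous_const he.continuous.norm).mem_nhds hp₀R] with y hy
    exact hfix y (le_of_lt hy)
  have hp₀S : e p₀ ∉ Metric.sphere (e a) r := fun hs =>
    disjoint_left.1 hSW (show p₀ ∈ S from hs) hp₀W
  have hβ : ∀ c ∈ W₁, LogEquivOn S (orbitProd h q e c) fun y => (e y - e p₀) ^ (q : ℤ) := by
    intro c hc
    have : LogEquivOn S (orbitProd h q e c) fun y => ∏ i ∈ Finset.range q, (e y - e p₀) := by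
      refine .prod _ fun i _ => (logEquivOn_sub_of_segment (u := fun y => e ((h ^ i) y))
        (he.continuous.comp (h ^ i).continuous).continuousOn (b := e p₀) fun y hy hs => ?_).trans ?_
      · have hm := (convex_ball (e a) r₁).segment_subset hc (Metric.ball_subset_ball hηr hz₀) hs
        have := apply_pow_eq_of_invariant (v := fun y => y ∈ W) (fun y => propext (hWinv y)) i y
        exact disjoint_left.1 hSW hy (this.mp (hW₁W hm))
      · refine logEquivOn_coordinate_of_eventuallyEq he hr.le hball
          ((he.continuous.comp (h ^ i).continuous).sub continuous_const) ?_ ?_ hp₀S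
        · filter_upwards [hfix₀] with y hy
          simp [hfixpow y hy]
        · intro y _ hyp h0
          refine hyp ((h ^ i).injective ?_)
          rw [he.injective (sub_eq_zero.1 h0), hfixpow _ hfix₀.self_of_nhds]
    simpa using this
  obtain ⟨k, hk⟩ := exists_logEquivOn_zpow_of_free_zeros hh hq0 he hDc hWo hWinv hSW hW₁W
    (fun u hu hu0 => by
      obtain ⟨G, hG, hGu⟩ := he.exists_log_on_disc hr.le hball hu.continuousOn hu0
      exact ⟨G, hG.continuousOn, fun y hy => by
        rw [one_mul]; exact hGu y (Metric.sphere_subset_closedBall hy)⟩)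
    hβ (v := fun y => A y - e p₁) (hAc.sub continuous_const) (fun y => by simp only [hAinv])
    (fun y hy h0 => by
      have hAy : A y = e p₁ := sub_eq_zero.1 h0
      refine ⟨?_, fun i hi0 hiq => pow_apply_ne_of_prime hq hh (fun hy' => ?_) hi0 hiq⟩
      · by_contra hyW
        have h1 := hηA y ⟨hy, hyW⟩
        have h2 : dist (e p₁) (e a) < η := hp₁η
        rw [hAy, ← dist_eq_norm] at h1
        linarith
      · rw [hAfix y hy'] at hAy
        exact hp₁ (he.injective hAy ▸ hy'))
  have h1 : LogEquivOn S (fun y => A y - e p₁) fun y => A y - e p₀ :=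
    logEquivOn_sub_of_segment hAc.continuousOn fun y hy hs => by
      have h1 := hηA y (hSD hy)
      have h2 : dist (A y) (e a) < η := (convex_ball (e a) η).segment_subset hp₁η hz₀ hs
      rw [dist_eq_norm] at h2
      linarith
  have h2 : LogEquivOn S (fun y => A y - e p₀) fun y => e y - e p₀ := by
    refine logEquivOn_coordinate_of_eventuallyEq he hr.le hball (hAc.sub continuous_const) ?_ ?_
      hp₀S
    · filter_upwards [hfix₀] with y hy
      rw [hAfix y hy]
    · intro y _ hyp h0
      have hAy : A y = e p₀ := sub_eq_zero.1 h0
      by_cases hy : h y = y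
      · exact hyp (he.injective (by rw [← hAfix y hy, hAy]))
      · have := hAlt y hy
        rw [hAy] at this
        linarith
  have h3 : LogEquivOn S (fun y => e y - e p₀) fun y => e y - e a :=
    logEquivOn_sub_of_segment he.continuous.continuousOn fun y hy hs => by
      have h2 : dist (e y) (e a) < r := (convex_ball (e a) r).segment_subset
        (hWball hp₀W) (Metric.mem_ball_self hr) hs
      have h1 : dist (e y) (e a) = r := hy
      linarith
  obtain ⟨g, hg, hgeq⟩ := ((h3.zpow (q : ℤ)).zpow k).symm.trans
    (hk.symm.trans (h1.trans (h2.trans h3)))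
  obtain ⟨G, hG, hGg⟩ := he.exists_pushforward Metric.isClosed_sphere
    (Metric.sphere_subset_closedBall.trans hball) hg
  -- The same function winds `q * k` times by its free zeros and once by comparison with `p₀`.
  have hzero := eq_zero_of_zpow_eq_exp_on_sphere hr (n := q * k - 1) hG.continuousOn (by
    intro z hz
    obtain ⟨y, rfl⟩ := hball (Metric.sphere_subset_closedBall hz)
    have hne : e y - e a ≠ 0 := by
      rw [← norm_pos_iff, ← dist_eq_norm, Metric.mem_sphere.1 hz]; exact hr
    have hgy := hgeq y hz
    simp only at hgy
    rw [zpow_sub₀ hne, zpow_mul, hgy, zpow_one, mul_div_cancel_left₀ _ hne, hGg y hz])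
  have : (q : ℤ) ∣ 1 := ⟨k, by linarith⟩
  exact hq.one_lt.ne' (by exact_mod_cast Int.eq_one_of_dvd_one (by positivity) this)

end FreeZeros

/-! ### Local form of Newman's theorem -/

/-- The local homeomorphism `z ↦ (z - b)⁻¹`. -/
noncomputable def invSubPartialHomeomorph (b : ℂ) : OpenPartialHomeomorph ℂ ℂ where
  toFun z := (z - b)⁻¹
  invFun w := w⁻¹ + b
  source := {b}ᶜ
  target := {0}ᶜ
  map_source' z hz := inv_ne_zero (sub_ne_zero.2 hz)
  map_target' w hw := by simpa using hw
  left_inv' z _ := by simp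
  right_inv' w _ := by simp
  open_source := isOpen_compl_singleton
  open_target := isOpen_compl_singleton
  continuousOn_toFun := (continuousOn_id.sub continuousOn_const).inv₀
    fun z hz => sub_ne_zero.2 hz
  continuousOn_invFun := (continuousOn_id.inv₀ fun w hw => hw).add continuousOn_const

theorem OpenPartialHomeomorph.isOpenEmbedding_domRestrict {X Z : Type*} [TopologicalSpace X]
    [TopologicalSpace Z] (F : OpenPartialHomeomorph X Z) {s : Set X} (hs : IsOpen s)
    (hsF : s ⊆ F.source) : IsOpenEmbedding (s.domRestrict F) := by
  have : IsOpenEmbedding (inclusion hsF) :=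
    .of_comp _ F.open_source.isOpenEmbedding_subtypeVal hs.isOpenEmbedding_subtypeVal
  exact F.isOpenEmbedding_restrict.comp this

section LocalPeriodic

variable {X : Type*} [TopologicalSpace X] {h : X → X}

/-- The two claims are proved together: openness at stage `j + 1` uses continuity of the `j`-th
iterate. -/
theorem isOpen_iterate_mem {U : Set X} (hU : IsOpen U) (hc : ∀ x ∈ U, ContinuousAt h x) (j : ℕ) :
    IsOpen {x | ∀ i < j, h^[i] x ∈ U} ∧ ∀ x, (∀ i < j, h^[i] x ∈ U) → ContinuousAt h^[j] x := by
  induction j with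
  | zero => simpa using fun x => continuousAt_id
  | succ j ih =>
    refine ⟨?_, fun x hx => ?_⟩
    · rw [isOpen_iff_mem_nhds]
      intro x hx
      have hx' : ∀ i < j, h^[i] x ∈ U := fun i hi => hx i (by lia)
      filter_upwards [ih.1.mem_nhds hx', ih.2 x hx' (hU.mem_nhds (hx j (by lia)))] with y hy hyj i hi
      rcases Nat.lt_succ_iff_lt_or_eq.1 hi with h | rfl
      exacts [hy i h, hyj]
    · rw [Function.iterate_succ']
      exact (hc _ (hx j (by lia))).comp (ih.2 x fun i hi => hx i (by lia))

theorem ContinuousAt.eventually_apply_ne [T2Space X] {a : X} (hc : ContinuousAt h a)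
    (ha : h a ≠ a) : ∀ᶠ x in 𝓝 a, h x ≠ x :=
  (hc.prodMk continuousAt_id).eventually (isClosed_diagonal.isOpen_compl.mem_nhds ha)

theorem apply_eq_of_mem_closure_fixed [T2Space X] {a : X} (hc : ContinuousAt h a)
    (ha : a ∈ closure {x | h x = x}) : h a = a := by
  by_contra hne
  obtain ⟨x, hx, hx'⟩ := mem_closure_iff_nhds.1 ha _ (hc.eventually_apply_ne hne)
  exact hx hx'

/-- A map on an open set which is periodic there restricts to a homeomorphism. -/
def homeomorphOfIterateEq {U : Set X} {n : ℕ} (hc : ContinuousOn h U) (hmap : MapsTo h U U)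
    (hper : ∀ x ∈ U, h^[n + 1] x = x) : U ≃ₜ U where
  toFun := hmap.restrict h U U
  invFun := (hmap.iterate n).restrict h^[n] U U
  left_inv x := Subtype.ext (by
    change h^[n] (h x) = x
    rw [← Function.iterate_succ_apply h n]; exact hper x x.2)
  right_inv x := Subtype.ext (by
    change h (h^[n] x) = x
    rw [← Function.iterate_succ_apply' h n]; exact hper x x.2)
  continuous_toFun := hc.mapsToRestrict hmap
  continuous_invFun := (hc.iterate hmap n).mapsToRestrict _

theorem homeomorphOfIterateEq_pow {U : Set X} {n : ℕ} (hc : ContinuousOn h U) (hmap : MapsTo h U U)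
    (hper : ∀ x ∈ U, h^[n + 1] x = x) : homeomorphOfIterateEq hc hmap hper ^ (n + 1) = 1 := by
  ext x
  have : ∀ (i : ℕ) (x : U), ((homeomorphOfIterateEq hc hmap hper)^[i] x : X) = h^[i] x := by
    intro i
    induction i with
    | zero => intro x; rfl
    | succ i ih => intro x; rw [Function.iterate_succ_apply, ih, Function.iterate_succ_apply]; rfl
  rw [Homeomorph.coe_pow_eq_iterate, this, hper x x.2]
  rfl

/-- Otherwise, blow up a disc about an interior fixed point `x₀` until it touches the moved set.
Inversion at `x₀` turns it into a fixed exterior of a disc with moved points accumulating at the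
contact point. -/
theorem eventually_fixed_of_prime_period [T2Space X] (E : OpenPartialHomeomorph X ℂ) {a : X}
    (haE : a ∈ E.source) (hc : ∀ᶠ x in 𝓝 a, ContinuousAt h x) {q : ℕ} (hq : q.Prime)
    (hper : ∀ᶠ x in 𝓝 a, h^[q] x = x) (hcl : a ∈ closure (interior {x | h x = x})) :
    ∀ᶠ x in 𝓝 a, h x = x := by
  by_contra hne
  have ha : h a = a :=
    apply_eq_of_mem_closure_fixed hc.self_of_nhds (closure_mono interior_subset hcl)
  obtain ⟨U₀, hU₀, hU₀o, haU₀⟩ := eventually_nhds_iff.1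
    (hc.and (hper.and (E.open_source.mem_nhds haE)))
  obtain ⟨hUo, hUc⟩ := isOpen_iterate_mem hU₀o (fun x hx => (hU₀ x hx).1) q
  set U : Set X := {x | ∀ i < q, h^[i] x ∈ U₀} with hU
  have hUU₀ : U ⊆ U₀ := fun x hx => hx 0 hq.pos
  have haU : a ∈ U := fun i _ => by rwa [Function.iterate_fixed ha]
  have hUper : ∀ x ∈ U, h^[q] x = x := fun x hx => (hU₀ x (hUU₀ hx)).2.1
  have hUE : U ⊆ E.source := fun x hx => (hU₀ x (hUU₀ hx)).2.2
  have hUmap : MapsTo h U U := by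
    intro x hx i hi
    rw [← Function.iterate_succ_apply]
    rcases (Nat.succ_le_of_lt hi).lt_or_eq with h1 | h1
    · exact hx _ h1
    · rw [h1, hUper x hx]; exact hUU₀ hx
  have hUcont : ∀ x ∈ U, ContinuousAt h x := fun x hx => (hU₀ x (hUU₀ hx)).1
  obtain ⟨ρ₀, hρ₀, hball⟩ := Metric.isOpen_iff.1 (E.isOpen_inter_preimage_symm hUo) (E a)
    ⟨E.map_source haE, by simpa [E.left_inv haE] using haU⟩
  set N : Set ℂ := Metric.ball (E a) ρ₀ ∩ (E.target ∩ E.symm ⁻¹' {x | x ∈ U ∧ h x ≠ x}) with hN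
  have hNo : IsOpen N := by
    refine Metric.isOpen_ball.inter (E.isOpen_inter_preimage_symm (isOpen_iff_mem_nhds.2 ?_))
    rintro x ⟨hxU, hx⟩
    exact Filter.inter_mem (hUo.mem_nhds hxU) ((hUcont x hxU).eventually_apply_ne hx)
  have hnear : ∀ ρ > 0, ∀ z, dist (E a) z < ρ → ∀ᶠ x in 𝓝 a, x ∈ E.source ∧ dist (E x) z < ρ := by
    intro ρ _ z hz
    exact Filter.Eventually.and (E.open_source.mem_nhds haE) ((E.continuousAt haE).eventually
      (Metric.isOpen_ball.mem_nhds hz))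
  -- Both `x₀` near `a` and a moved point near `x₀` are taken within `ρ₀ / 2`, so the touching disc
  -- about `b` stays in the ball of radius `ρ₀`.
  obtain ⟨x₀, ⟨⟨hx₀E, hx₀⟩, hx₀U⟩, hx₀fix⟩ := mem_closure_iff_nhds.1 hcl _
    ((hnear (ρ₀ / 2) (half_pos hρ₀) (E a) (by simpa using hρ₀)).and (hUo.mem_nhds haU))
  set b := E x₀ with hb
  obtain ⟨x₁, hx₁, ⟨hx₁E, hx₁b⟩, ⟨-, hx₁a⟩, hx₁U⟩ := ((Filter.not_eventually.1 hne).and_eventually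
    ((hnear (ρ₀ / 2) (half_pos hρ₀) b (by rw [dist_comm]; exact hx₀)).and
      ((hnear ρ₀ hρ₀ (E a) (by simpa using hρ₀)).and (hUo.mem_nhds haU)))).exists
  have hmemN : ∀ x ∈ U, E x ∈ Metric.ball (E a) ρ₀ → (E x ∈ N ↔ h x ≠ x) := by
    intro x hxU hxb
    have hxE := hUE hxU
    simp [hN, Metric.mem_ball.1 hxb, E.map_source hxE, E.left_inv hxE, hxU]
  have hx₁N : E x₁ ∈ N := (hmemN x₁ hx₁U hx₁a).2 hx₁
  have hbN : b ∉ closure N := by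
    intro hbc
    have h1 : ∀ᶠ z in 𝓝 b, h (E.symm z) = E.symm z := by
      have h2 : Filter.Tendsto E.symm (𝓝 b) (𝓝 x₀) := by
        simpa [hb, E.left_inv hx₀E] using (E.continuousAt_symm (E.map_source hx₀E)).tendsto
      exact (h2.eventually (isOpen_interior.mem_nhds hx₀fix)).mono fun z hz => interior_subset (s := {x | h x = x}) hz
    obtain ⟨z, hz, hzN⟩ := mem_closure_iff_nhds.1 hbc _ h1
    exact hzN.2.2.2 hz
  set ρ := Metric.infDist b N with hρ
  have hρ0 : 0 < ρ := (Metric.infDist_pos_iff_notMem_closure ⟨_, hx₁N⟩).1 hbN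
  have hρlt : ρ < ρ₀ / 2 := (Metric.infDist_le_dist_of_mem hx₁N).trans_lt (by rwa [dist_comm])
  obtain ⟨z, hzN, hzρ⟩ := isClosed_closure.exists_infDist_eq_dist
    (closure_nonempty_iff.2 ⟨_, hx₁N⟩) b
  rw [Metric.infDist_closure, ← hρ] at hzρ
  have hclose : ∀ w, dist w b ≤ ρ → w ∈ Metric.ball (E a) ρ₀ := fun w hw => by
    have := dist_triangle w b (E a)
    rw [Metric.mem_ball]
    linarith
  -- The inequality is strict because `N` is open: a point of `N` at distance exactly `ρ` would have
  -- points of `N` closer to `b` nearby. Thus the closed disc consists of fixed points.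
  have hNfar : ∀ w ∈ N, ρ < dist w b := by
    intro w hw
    refine lt_of_le_of_ne (by rw [dist_comm]; exact Metric.infDist_le_dist_of_mem hw) fun heq => ?_
    have hwc : w ∈ closure (Metric.ball b ρ) := by
      rw [closure_ball b hρ0.ne']; exact heq.ge
    obtain ⟨w', hw'N, hw'⟩ := mem_closure_iff.1 hwc N hNo hw
    have := Metric.infDist_le_dist_of_mem (x := b) hw'N
    rw [dist_comm] at this
    exact absurd hw' (not_lt.2 this)
  have hzball := hclose z (by rw [dist_comm, ← hzρ])
  obtain ⟨hzt, hzU⟩ := hball hzball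
  -- the coordinate obtained by inverting at the centre of the disc of fixed points
  set V : Set X := U ∩ {x₀}ᶜ with hV
  have hVo : IsOpen V := hUo.inter isOpen_compl_singleton
  have hhx₀ : h x₀ = x₀ := interior_subset (s := {x | h x = x}) hx₀fix
  have hinj : ∀ x ∈ U, ∀ y ∈ U, h x = h y → x = y := by
    intro x hx y hy hxy
    obtain ⟨n, rfl⟩ := Nat.exists_eq_succ_of_ne_zero hq.ne_zero
    rw [← hUper x hx, ← hUper y hy, Function.iterate_succ_apply, hxy, Function.iterate_succ_apply]
  have hVmap : MapsTo h V V := fun x hx =>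
    ⟨hUmap hx.1, fun hx' => hx.2 (hinj x hx.1 x₀ hx₀U (by rw [hhx₀]; exact hx'))⟩
  have hVcont : ContinuousOn h V := fun x hx => (hUcont x hx.1).continuousWithinAt
  obtain ⟨n, rfl⟩ := Nat.exists_eq_succ_of_ne_zero hq.ne_zero
  have hVper : ∀ x ∈ V, h^[n + 1] x = x := fun x hx => hUper x hx.1
  let H := homeomorphOfIterateEq hVcont hVmap hVper
  have hVne : ∀ x ∈ V, E x ≠ b := fun x hx hxb => hx.2 (E.injOn (hUE hx.1) hx₀E hxb)
  have hemb : IsOpenEmbedding (V.domRestrict (E.trans (invSubPartialHomeomorph b))) := by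
    refine OpenPartialHomeomorph.isOpenEmbedding_domRestrict _ hVo fun x hx => ?_
    rw [OpenPartialHomeomorph.trans_source]
    exact ⟨hUE hx.1, hVne x hx⟩
  have hnorm : ∀ x : V, ‖V.domRestrict (E.trans (invSubPartialHomeomorph b)) x‖ = (dist (E x) b)⁻¹ := by
    intro x
    rw [dist_eq_norm, ← norm_inv]
    rfl
  have hz₀ : E.symm z ∈ V := ⟨hzU, fun hzx => by
    rw [← E.right_inv hzt, mem_singleton_iff.1 hzx, dist_self] at hzρ
    exact hρ0.ne' hzρ⟩
  refine false_of_fixed_outside_disc (h := H) hq (homeomorphOfIterateEq_pow hVcont hVmap hVper)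
    hemb (inv_pos.2 hρ0) (a := ⟨E.symm z, hz₀⟩) ?_ ?_ ?_
  · rw [hnorm, E.right_inv hzt, dist_comm, ← hzρ]
  · intro y hy
    rw [hnorm, inv_le_inv₀ hρ0 (dist_pos.2 (hVne y y.2))] at hy
    by_contra hne'
    have hyN := (hmemN y y.2.1 (hclose _ hy)).2 fun hyy => hne' (Subtype.ext hyy)
    exact not_le.2 (hNfar _ hyN) hy
  · rw [mem_closure_iff_nhds]
    intro t ht
    obtain ⟨t', ht', htt'⟩ := mem_nhds_subtype _ _ _ |>.1 ht
    have h1 : E.symm ⁻¹' (t' ∩ V) ∈ 𝓝 z := (E.continuousAt_symm hzt).preimage_mem_nhds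
      (Filter.inter_mem ht' (hVo.mem_nhds hz₀))
    obtain ⟨w, ⟨hwt, hwV⟩, hwN⟩ := mem_closure_iff_nhds.1 hzN _ h1
    exact ⟨⟨E.symm w, hwV⟩, htt' hwt, fun hw => hwN.2.2.2 (congrArg Subtype.val hw)⟩

/-- Newman's theorem in dimension two, local form: a map which is periodic near `a` and fixes an
open set adherent to `a` is the identity near `a`. -/
theorem eventually_fixed_of_period [T2Space X] (E : OpenPartialHomeomorph X ℂ) {a : X}
    (haE : a ∈ E.source) {s : ℕ} (hs : s ≠ 0) (hc : ∀ᶠ x in 𝓝 a, ContinuousAt h x)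
    (hper : ∀ᶠ x in 𝓝 a, h^[s] x = x) (hcl : a ∈ closure (interior {x | h x = x})) :
    ∀ᶠ x in 𝓝 a, h x = x := by
  induction s using Nat.recOnMul generalizing h with
  | zero => exact absurd rfl hs
  | one => simpa using hper
  | prime q hq => exact eventually_fixed_of_prime_period E haE hc hq hper hcl
  | mul m n ihm ihn =>
    have hm : m ≠ 0 := fun h0 => hs (by simp [h0])
    have hn : n ≠ 0 := fun h0 => hs (by simp [h0])
    have ha : h a = a :=
      apply_eq_of_mem_closure_fixed hc.self_of_nhds (closure_mono interior_subset hcl)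
    have hcm : ∀ᶠ x in 𝓝 a, ContinuousAt h^[m] x := by
      obtain ⟨U, hU, hUo, haU⟩ := eventually_nhds_iff.1 hc
      obtain ⟨ho, hco⟩ := isOpen_iterate_mem hUo hU m
      filter_upwards [ho.mem_nhds fun i _ => by rwa [Function.iterate_fixed ha]] with x hx
      exact hco x hx
    -- The iterate `h^[m]` has period `n`, so it is the identity near `a`; then `h` itself has
    -- period `m` there.
    refine ihm hm hc (ihn (h := h^[m]) hn hcm ?_ ?_) hcl
    · simpa only [← Function.iterate_mul] using hper
    · exact closure_mono (interior_mono fun x hx => Function.iterate_fixed hx m) hcl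

end LocalPeriodic

/-! ### Montgomery's theorem for surfaces -/

theorem pow_mul_apply_eq {M : Type*} [TopologicalSpace M] {f : M ≃ₜ M} {m : ℕ} {x : M} (hx : (f ^ m) x = x) (n : ℕ) :
    (f ^ (n * m)) x = x := by
  rw [mul_comm, pow_mul, Homeomorph.coe_pow_eq_iterate]
  exact Function.iterate_fixed hx n

section PointwisePeriodic

variable {M : Type*} [TopologicalSpace M] [T2Space M]

theorem isClosed_fixed_pow (f : M ≃ₜ M) (n : ℕ) : IsClosed {x | (f ^ n) x = x} :=
  isClosed_eq (f ^ n).continuous continuous_id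

/-- Newman's theorem for `f ^ n`, which has period `m` near `x`: away from the bad set, interiors of
fixed sets are relatively closed. -/
theorem mem_interior_fixed_of_mem_closure
    (hM : ∀ x : M, ∃ E : OpenPartialHomeomorph M ℂ, x ∈ E.source) (f : M ≃ₜ M) {m n : ℕ}
    (hm : m ≠ 0) {x : M} (hxm : x ∈ interior {x | (f ^ m) x = x})
    (hxn : x ∈ closure (interior {x | (f ^ n) x = x})) : x ∈ interior {x | (f ^ n) x = x} := by
  obtain ⟨E, hE⟩ := hM x
  refine mem_interior_iff_mem_nhds.2 (eventually_fixed_of_period (h := f ^ n) E hE hm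
    (.of_forall fun y => (f ^ n).continuous.continuousAt) ?_ hxn)
  filter_upwards [mem_interior_iff_mem_nhds.1 hxm] with y hy
  rw [← Homeomorph.coe_pow_eq_iterate, ← pow_mul]
  exact pow_mul_apply_eq hy n

/-- Montgomery's theorem for surfaces: a pointwise periodic homeomorphism of a compact connected
surface is periodic. -/
theorem isPeriodicHomeo_of_pointwise [CompactSpace M] [PreconnectedSpace M]
    (hM : ∀ x : M, ∃ E : OpenPartialHomeomorph M ℂ, x ∈ E.source) (f : M ≃ₜ M)
    (hf : ∀ x, ∃ n : ℕ, 0 < n ∧ (f ^ n) x = x) : IsPeriodicHomeo f := by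
  classical
  rcases isEmpty_or_nonempty M with hem | ⟨⟨x₀⟩⟩
  · exact ⟨1, one_pos, by ext x; exact hem.elim x⟩
  let I : ℕ → Set M := fun n => interior {x | (f ^ n) x = x}
  set B : Set M := (⋃ n, I (n + 1))ᶜ with hB
  have hBcl : IsClosed B := (isOpen_iUnion fun n => isOpen_interior).isClosed_compl
  have hBI : ∀ {n x}, 0 < n → x ∈ I n → x ∉ B := fun {n x} hn hx hxB =>
    hxB (mem_iUnion.2 ⟨n - 1, by rwa [Nat.sub_add_cancel hn]⟩)
  have hnB : ∀ {x}, x ∉ B → ∃ m, m ≠ 0 ∧ x ∈ I m := by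
    intro x hx
    obtain ⟨n, hn⟩ := mem_iUnion.1 (not_not.1 hx)
    exact ⟨n + 1, n.succ_ne_zero, hn⟩
  have hclosed : ∀ {s x}, x ∉ B → x ∈ closure (I s) → x ∈ I s := by
    intro s x hxB hxs
    obtain ⟨m, hm, hxm⟩ := hnB hxB
    exact mem_interior_fixed_of_mem_closure hM f hm hxm hxs
  rcases B.eq_empty_or_nonempty with hBe | ⟨b, hb⟩
  · obtain ⟨n, hn, hxn⟩ := hnB (hBe ▸ notMem_empty x₀ : x₀ ∉ B)
    have hcl : IsClopen (I n) := ⟨isClosed_of_closure_subset fun x hx =>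
      hclosed (hBe ▸ notMem_empty x) hx, isOpen_interior⟩
    have huniv := hcl.eq_univ ⟨x₀, hxn⟩
    refine ⟨n, Nat.pos_of_ne_zero hn, ?_⟩
    ext x
    exact interior_subset (s := {x | (f ^ n) x = x}) (huniv ▸ mem_univ x : x ∈ I n)
  exfalso
  have : CompactSpace B := isCompact_iff_compactSpace.1 hBcl.isCompact
  have : Nonempty B := ⟨⟨b, hb⟩⟩
  -- Baire on the bad set `B`: one power fixes a nonempty relatively open piece of it.
  obtain ⟨k, ⟨a, haB⟩, ha⟩ := nonempty_interior_of_iUnion_of_closed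
    (f := fun n : ℕ => {x : B | (f ^ (n + 1)) (x : M) = x})
    (fun n => (isClosed_fixed_pow f (n + 1)).preimage continuous_subtype_val)
    (by
      refine eq_univ_of_forall fun x => mem_iUnion.2 ?_
      obtain ⟨n, hn, hx⟩ := hf x
      exact ⟨n - 1, by simpa [Nat.sub_add_cancel hn] using hx⟩)
  obtain ⟨O, hO, haO⟩ := mem_nhds_subtype _ _ _ |>.1 (mem_interior_iff_mem_nhds.1 ha)
  obtain ⟨E, hE⟩ := hM a
  obtain ⟨U, hUO, hUo, haU⟩ := mem_nhds_iff.1 hO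
  obtain ⟨ρ, hρ, hball⟩ := Metric.isOpen_iff.1 (E.isOpen_inter_preimage_symm hUo) (E a)
    ⟨E.map_source hE, by simpa [E.left_inv hE] using haU⟩
  set N : Set M := E.symm '' Metric.ball (E a) ρ with hN
  have hNo : IsOpen N := E.symm.isOpen_image_of_subset_source Metric.isOpen_ball
    (hball.trans inter_subset_left)
  have hNc : IsPreconnected N := (convex_ball (E a) ρ).isPreconnected.image _
    (E.symm.continuousOn.mono (hball.trans inter_subset_left))
  have haN : a ∈ N := ⟨E a, Metric.mem_ball_self hρ, E.left_inv hE⟩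
  have hNB : ∀ x ∈ N, x ∈ B → (f ^ (k + 1)) x = x := by
    rintro _ ⟨z, hz, rfl⟩ hxB
    exact haO (a := ⟨E.symm z, hxB⟩) (hUO (hball hz).2)
  have hfix : ∀ s, 0 < s → ∀ x ∈ N, x ∈ I s → (f ^ (k + 1)) x = x := by
    intro s hs
    -- Gluing `f ^ (k + 1)` on `I s` to the identity is continuous on `N`: boundary points of `I s`
    -- in `N` are bad, hence fixed by `f ^ (k + 1)`. The glued map has period `s`, so Newman's
    -- theorem applies.
    let h : M → M := fun x => if x ∈ I s then (f ^ (k + 1)) x else x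
    have hcont : ∀ x ∈ N, ContinuousAt h x := by
      intro x hx
      by_cases hxs : x ∈ I s
      · have : h =ᶠ[𝓝 x] ⇑(f ^ (k + 1)) := by
          filter_upwards [isOpen_interior.mem_nhds hxs] with y hy
          exact if_pos hy
        exact (f ^ (k + 1)).continuous.continuousAt.congr this.symm
      by_cases hxB : x ∈ B
      · have h1 : Filter.Tendsto (f ^ (k + 1)) (𝓝 x) (𝓝 x) := by
          simpa only [hNB x hx hxB] using (f ^ (k + 1)).continuous.tendsto x
        have : h x = x := if_neg hxs
        rw [ContinuousAt, this]
        exact h1.if' Filter.tendsto_id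
      · have : h =ᶠ[𝓝 x] id := by
          filter_upwards [isClosed_closure.isOpen_compl.mem_nhds
            (fun hc => hxs (hclosed hxB hc) : x ∈ (closure (I s))ᶜ)] with y hy
          exact if_neg fun hys => hy (subset_closure hys)
        exact continuousAt_id.congr this.symm
    have hmap : ∀ x ∈ I s, (f ^ (k + 1)) x ∈ I s := by
      intro x hx
      refine interior_maximal ?_ ((f ^ (k + 1)).isOpenMap _ isOpen_interior) (mem_image_of_mem _ hx)
      rintro _ ⟨y, hy, rfl⟩
      have hys : (f ^ s) y = y := interior_subset (s := {x | (f ^ s) x = x}) hy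
      rw [mem_ofPred_eq, ← Homeomorph.mul_apply, ← pow_add, add_comm, pow_add, Homeomorph.mul_apply,
        hys]
    have hper : ∀ x, h^[s] x = x := by
      intro x
      by_cases hxs : x ∈ I s
      · have : ∀ i : ℕ, h^[i] x = ((f ^ (k + 1)) ^ i) x ∧ h^[i] x ∈ I s := by
          intro i
          induction i with
          | zero => exact ⟨rfl, hxs⟩
          | succ i ih =>
            have h1 : h^[i + 1] x = (f ^ (k + 1)) (h^[i] x) := by
              rw [Function.iterate_succ_apply']
              exact if_pos ih.2
            refine ⟨?_, h1 ▸ hmap _ ih.2⟩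
            rw [h1, ih.1, ← Homeomorph.mul_apply, ← pow_succ']
        rw [(this s).1, ← pow_mul]
        exact pow_mul_apply_eq (interior_subset (s := {x | (f ^ s) x = x}) hxs) _
      · have : h x = x := if_neg hxs
        exact Function.iterate_fixed this s
    have hsub : N ⊆ interior {x | h x = x} := by
      refine hNc.subset_of_closure_inter_subset isOpen_interior ?_ ?_
      -- If `h` were the identity on no open part of `N`, then `I s` would be dense in `N`, so `f ^
      -- s` would fix `N` and `a` would not be bad.
      · by_contra hemp
        have hNs : N ⊆ closure (I s) := by
          intro x hx
          by_contra hxc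
          refine hemp ⟨x, hx, mem_interior.2 ⟨(closure (I s))ᶜ, fun y hy => ?_,
            isClosed_closure.isOpen_compl, hxc⟩⟩
          exact if_neg fun hys => hy (subset_closure hys)
        exact hBI hs (interior_maximal (hNs.trans ((isClosed_fixed_pow f s).closure_subset_iff.2
          interior_subset)) hNo haN) haB
      · rintro x ⟨hxc, hxN⟩
        obtain ⟨E', hE'⟩ := hM x
        refine mem_interior_iff_mem_nhds.2 (eventually_fixed_of_period E' hE' hs.ne' ?_
          (.of_forall hper) hxc)
        filter_upwards [hNo.mem_nhds hxN] with y hy using hcont y hy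
    intro x hx hxs
    have : h x = x := interior_subset (s := {x | h x = x}) (hsub hx)
    rwa [show h x = (f ^ (k + 1)) x from if_pos hxs] at this
  -- Baire on `M`: the identity `f ^ (k + 1) x = x` extends from a dense part of `N` to all of `N`,
  -- contradicting `a ∈ B`.
  have hdense : Dense (⋃ n, I (n + 1)) := by
    refine dense_iUnion_interior_of_closed (fun n => isClosed_fixed_pow f (n + 1))
      (eq_univ_of_forall fun x => mem_iUnion.2 ?_)
    obtain ⟨n, hn, hx⟩ := hf x
    exact ⟨n - 1, by simpa [Nat.sub_add_cancel hn] using hx⟩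
  refine hBI k.succ_pos (interior_maximal (fun x hx => ?_) hNo haN) haB
  have h1 : N ⊆ closure (N ∩ ⋃ n, I (n + 1)) := hdense.open_subset_closure_inter hNo
  refine (isClosed_fixed_pow f (k + 1)).closure_subset_iff.2 ?_ (h1 hx)
  rintro y ⟨hyN, hy⟩
  obtain ⟨n, hn⟩ := mem_iUnion.1 hy
  exact hfix (n + 1) n.succ_pos y hyN hn

end PointwisePeriodic

/-! ### The suspension space and its flow lines -/

namespace Suspension

variable {X : Type*} [TopologicalSpace X] (f : X ≃ₜ X)

theorem mk_eq_mk_iff {a b : X × ℝ} :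
    mk f a = mk f b ↔ ∃ n : ℤ, b.1 = (f ^ n) a.1 ∧ a.2 = b.2 + n :=
  Quotient.eq (r := suspensionSetoid f)

theorem mk_zpow (n : ℤ) (x : X) (s : ℝ) : mk f ((f ^ n) x, s - n) = mk f (x, s) :=
  ((mk_eq_mk_iff f).2 ⟨n, rfl, by simp⟩).symm

theorem flow_mk (t s : ℝ) (x : X) : flow f t (mk f (x, s)) = mk f (x, s + t) := rfl

theorem exists_mk (z : Suspension f) : ∃ x s, mk f (x, s) = z := by
  obtain ⟨⟨x, s⟩, h⟩ := (isQuotientMap_mk f).surjective z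
  exact ⟨x, s, h⟩

theorem locallyFinite_int_singleton : LocallyFinite fun n : ℤ => ({(n : ℝ)} : Set ℝ) := by
  intro x
  refine ⟨Metric.ball x 1, Metric.ball_mem_nhds x one_pos,
    (Set.finite_Icc ⌊x - 1⌋ ⌈x + 1⌉).subset ?_⟩
  rintro n ⟨y, rfl, hy⟩
  rw [Metric.mem_ball, Real.dist_eq, abs_lt] at hy
  constructor
  · have h : (⌊x - 1⌋ : ℝ) ≤ n := (Int.floor_le (x - 1)).trans (by linarith)
    exact_mod_cast h
  · have h : (n : ℝ) ≤ ⌈x + 1⌉ := (by linarith : (n : ℝ) ≤ x + 1).trans (Int.le_ceil (x + 1))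
    exact_mod_cast h

instance [T2Space X] : T2Space (Suspension f) := by
  rw [t2Space_iff_of_isOpenQuotientMap (isOpenQuotientMap_mk f)]
  have : {p : (X × ℝ) × (X × ℝ) | mk f p.1 = mk f p.2} =
      ⋃ n : ℤ, {p | p.2.1 = (f ^ n) p.1.1 ∧ p.1.2 - p.2.2 = (n : ℝ)} := by
    ext p
    simp only [mem_iUnion]
    exact (mk_eq_mk_iff f).trans (exists_congr fun n => and_congr_right fun _ => by
      rw [sub_eq_iff_eq_add'])
  rw [this]
  refine LocallyFinite.isClosed_iUnion ?_ fun n => ?_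
  · have h1 : Continuous fun p : (X × ℝ) × (X × ℝ) => p.1.2 - p.2.2 := by fun_prop
    exact (locallyFinite_int_singleton.preimage_continuous h1).subset fun n p hp => hp.2
  · have : Continuous (f ^ n) := (f ^ n).continuous
    exact (isClosed_eq (by fun_prop) (by fun_prop)).inter (isClosed_eq (by fun_prop) (by fun_prop))

instance [SecondCountableTopology X] : SecondCountableTopology (Suspension f) :=
  (isQuotientMap_mk f).secondCountableTopology (isOpenMap_mk f)

instance [CompactSpace X] : CompactSpace (Suspension f) := by
  refine ⟨?_⟩
  have : mk f '' (univ ×ˢ Icc 0 1) = univ := by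
    refine eq_univ_of_forall fun z => ?_
    obtain ⟨x, s, rfl⟩ := exists_mk f z
    exact ⟨((f ^ ⌊s⌋) x, s - ⌊s⌋), ⟨trivial, Int.fract_nonneg s, (Int.fract_lt_one s).le⟩,
      mk_zpow f _ _ _⟩
  rw [← this]
  exact (isCompact_univ.prod isCompact_Icc).image (continuous_mk f)

theorem mk_mem_orbit_iff {x y : X} {s t : ℝ} :
    mk f (y, t) ∈ range (fun r : ℝ => flow f r (mk f (x, s))) ↔ y ∈ homeoOrbit f x := by
  constructor
  · rintro ⟨r, hr⟩
    obtain ⟨n, hn, -⟩ := (mk_eq_mk_iff f).1 hr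
    exact ⟨n, hn.symm⟩
  · rintro ⟨n, rfl⟩
    refine ⟨t + n - s, (mk_eq_mk_iff f).2 ⟨n, rfl, ?_⟩⟩
    simp

/-- For an open continuous map, preimage commutes with closure, and the preimage of a flow line is
an orbit times `ℝ`. -/
theorem mk_mem_closure_orbit_iff {x y : X} {s t : ℝ} :
    mk f (y, t) ∈ closure (range fun r : ℝ => flow f r (mk f (x, s))) ↔
      y ∈ closure (homeoOrbit f x) := by
  have h1 : mk f ⁻¹' (range fun r : ℝ => flow f r (mk f (x, s))) = homeoOrbit f x ×ˢ univ := by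
    ext ⟨y, t⟩
    simp [← mk_mem_orbit_iff f (s := s) (t := t)]
  rw [← mem_preimage,
    (isOpenMap_mk f).preimage_closure_eq_closure_preimage (continuous_mk f), h1, closure_prod_eq]
  simp

theorem rClosed_orbit (hf : IsRClosedHomeo f) :
    RClosed fun z : Suspension f => range fun r : ℝ => flow f r z := by
  have hq := ((isOpenQuotientMap_mk f).prodMap (isOpenQuotientMap_mk f)).isQuotientMap
  rw [RClosed, ← hq.isClosed_preimage]
  have : Prod.map (mk f) (mk f) ⁻¹'
      {p : Suspension f × Suspension f | p.2 ∈ closure (range fun r : ℝ => flow f r p.1)} =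
      (fun p : (X × ℝ) × (X × ℝ) => (p.1.1, p.2.1)) ⁻¹'
        {p : X × X | p.2 ∈ closure (homeoOrbit f p.1)} := by
    ext ⟨⟨x, s⟩, ⟨y, t⟩⟩
    exact mk_mem_closure_orbit_iff f
  rw [this]
  exact hf.preimage (by fun_prop)

theorem not_dense_orbit (hf : ¬ IsMinimalHomeo f) :
    ∃ z : Suspension f, ¬ Dense (range fun r : ℝ => flow f r z) := by
  simp only [IsMinimalHomeo, not_forall] at hf
  obtain ⟨x, hx⟩ := hf
  exact ⟨mk f (x, 0), fun hd => hx fun y => (mk_mem_closure_orbit_iff f).1 (hd (mk f (y, 0)))⟩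

/-! ### The foliation by flow lines -/

theorem mem_window (t : ℝ) : t ∈ Ioo (t - 1 / 2) (t + 1 / 2) := by
  constructor <;> linarith

/-- The suspension is a product on time windows of length one. -/
noncomputable def window (t₀ : ℝ) [Nonempty X] : OpenPartialHomeomorph (X × ℝ) (Suspension f) :=
  OpenPartialHomeomorph.ofContinuousOpenRestrict
    (InjOn.toPartialEquiv (mk f) (univ ×ˢ Ioo (t₀ - 1 / 2) (t₀ + 1 / 2)) (by
      rintro ⟨x, s⟩ ⟨-, hs⟩ ⟨y, t⟩ ⟨-, ht⟩ h
      obtain ⟨n, hn, hst⟩ := (mk_eq_mk_iff f).1 h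
      simp only [mem_Ioo] at hs ht hst
      have h0 : n = 0 := by
        have h1 : (n : ℝ) < 1 := by linarith
        have h2 : (-1 : ℝ) < n := by linarith
        have h1 : n < 1 := by exact_mod_cast h1
        have h2 : -1 < n := by exact_mod_cast h2
        lia
      subst h0
      simp_all))
    (continuous_mk f).continuousOn
    ((isOpenMap_mk f).domRestrict (isOpen_univ.prod isOpen_Ioo))
    (isOpen_univ.prod isOpen_Ioo)

theorem window_symm_mk [Nonempty X] {t₀ s : ℝ} (x : X) (hs : s ∈ Ioo (t₀ - 1 / 2) (t₀ + 1 / 2)) :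
    (window f t₀).symm (mk f (x, s)) = (x, s) :=
  (window f t₀).left_inv (x := (x, s)) ⟨trivial, hs⟩

/-- The linear coordinate of the leaves. -/
noncomputable def lineCoordinate : ℝ ≃ₜ EuclideanSpace ℝ (Fin 1) :=
  (ContinuousLinearEquiv.ofFinrankEq (𝕜 := ℝ) (by simp)).toHomeomorph

variable [Nonempty X]

/-- The flow box of a chart and a time window. -/
noncomputable def flowBox (E : OpenPartialHomeomorph X (EuclideanSpace ℝ (Fin 2))) (t₀ : ℝ) :
    OpenPartialHomeomorph (Suspension f)
      (EuclideanSpace ℝ (Fin 1) × EuclideanSpace ℝ (Fin 2)) :=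
  (window f t₀).symm.trans ((E.prod lineCoordinate.toOpenPartialHomeomorph).trans
    (Homeomorph.prodComm _ _).toOpenPartialHomeomorph)

variable {f} {E E' : OpenPartialHomeomorph X (EuclideanSpace ℝ (Fin 2))} {t₀ t₁ : ℝ}

theorem mk_mem_flowBox_source {x : X} {s : ℝ} (hx : x ∈ E.source)
    (hs : s ∈ Ioo (t₀ - 1 / 2) (t₀ + 1 / 2)) : mk f (x, s) ∈ (flowBox f E t₀).source := by
  have h1 : mk f (x, s) ∈ (window f t₀).target :=
    (window f t₀).map_source (x := (x, s)) ⟨trivial, hs⟩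
  simp [flowBox, h1, window_symm_mk f x hs, hx]

theorem flowBox_mk {x : X} {s : ℝ} (hs : s ∈ Ioo (t₀ - 1 / 2) (t₀ + 1 / 2)) :
    flowBox f E t₀ (mk f (x, s)) = (lineCoordinate s, E x) := by
  simp [flowBox, window_symm_mk f x hs]

theorem exists_of_mem_flowBox_source {z : Suspension f} (hz : z ∈ (flowBox f E t₀).source) :
    ∃ x ∈ E.source, ∃ s ∈ Ioo (t₀ - 1 / 2) (t₀ + 1 / 2), mk f (x, s) = z := by
  rw [flowBox, OpenPartialHomeomorph.trans_source] at hz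
  obtain ⟨hzt, hz⟩ := hz
  refine ⟨((window f t₀).symm z).1, ?_, ((window f t₀).symm z).2,
    ((window f t₀).map_target hzt).2, (window f t₀).right_inv hzt⟩
  simpa [OpenPartialHomeomorph.trans_source] using hz

theorem exists_flowBox_symm {p : EuclideanSpace ℝ (Fin 1) × EuclideanSpace ℝ (Fin 2)}
    (hp : p ∈ (flowBox f E t₀).target) :
    ∃ x ∈ E.source, E x = p.2 ∧
      (flowBox f E t₀).symm p = mk f (x, lineCoordinate.symm p.1) := by
  obtain ⟨x, hx, s, hs, h⟩ := exists_of_mem_flowBox_source ((flowBox f E t₀).map_target hp)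
  have h1 := (flowBox f E t₀).right_inv hp
  rw [← h, flowBox_mk hs] at h1
  refine ⟨x, hx, congrArg Prod.snd h1, ?_⟩
  rw [← h, ← h1, Homeomorph.symm_apply_apply]

/-- Near a point the identification of two windows uses a fixed integer `n`, so the transverse
coordinate changes by `f ^ n` read in charts, independently of time. -/
theorem isFoliatedOn_transition (E E' : OpenPartialHomeomorph X (EuclideanSpace ℝ (Fin 2)))
    (t₀ t₁ : ℝ) : IsFoliatedOn ((flowBox f E t₀).symm.trans (flowBox f E' t₁))
      ((flowBox f E t₀).symm.trans (flowBox f E' t₁)).source := by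
  refine ⟨OpenPartialHomeomorph.continuousOn _, fun p hp => ?_⟩
  have hmem : ∀ {p}, p ∈ ((flowBox f E t₀).symm.trans (flowBox f E' t₁)).source →
      p ∈ (flowBox f E t₀).target ∧ (flowBox f E t₀).symm p ∈ (flowBox f E' t₁).source :=
    fun h => by rwa [OpenPartialHomeomorph.trans_source] at h
  obtain ⟨hpt, hps⟩ := hmem hp
  obtain ⟨x, hx, hxp, hpx⟩ := exists_flowBox_symm hpt
  obtain ⟨y, hy, s, hs, hys⟩ := exists_of_mem_flowBox_source hps
  rw [hpx] at hys
  obtain ⟨n, -, hn⟩ := (mk_eq_mk_iff f).1 hys.symm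
  simp only at hn
  have hc : Continuous fun r : EuclideanSpace ℝ (Fin 1) × EuclideanSpace ℝ (Fin 2) =>
      lineCoordinate.symm r.1 - n :=
    (lineCoordinate.symm.continuous.comp continuous_fst).sub continuous_const
  have hV : (fun r : EuclideanSpace ℝ (Fin 1) × EuclideanSpace ℝ (Fin 2) =>
      lineCoordinate.symm r.1 - n) ⁻¹' Ioo (t₁ - 1 / 2) (t₁ + 1 / 2) ∈ 𝓝 p :=
    (isOpen_Ioo.preimage hc).mem_nhds (by
      rw [mem_preimage, hn, add_sub_cancel_right]
      exact hs)
  have key : ∀ r ∈ (fun r : EuclideanSpace ℝ (Fin 1) × EuclideanSpace ℝ (Fin 2) =>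
      lineCoordinate.symm r.1 - n) ⁻¹' Ioo (t₁ - 1 / 2) (t₁ + 1 / 2) ∩
      ((flowBox f E t₀).symm.trans (flowBox f E' t₁)).source, ∃ w ∈ E.source, E w = r.2 ∧
      (((flowBox f E t₀).symm.trans (flowBox f E' t₁)) r).2 = E' ((f ^ n) w) := by
    rintro r ⟨hrV, hr⟩
    obtain ⟨hrt, hrs⟩ := hmem hr
    obtain ⟨w, hw, hwr, hrw⟩ := exists_flowBox_symm hrt
    refine ⟨w, hw, hwr, ?_⟩
    rw [OpenPartialHomeomorph.trans_apply, hrw, ← mk_zpow f n, flowBox_mk hrV]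
  refine ⟨_, hV, fun u hu v hv huv => ?_⟩
  obtain ⟨w, hw, hwu, hw'⟩ := key u hu
  obtain ⟨w₂, hw₂, hwv, hw₂'⟩ := key v hv
  rw [hw', hw₂', E.injOn hw hw₂ (by rw [hwu, hwv, huv])]

theorem transition_mem_foliationGroupoid
    (E E' : OpenPartialHomeomorph X (EuclideanSpace ℝ (Fin 2))) (t₀ t₁ : ℝ) :
    (flowBox f E t₀).symm.trans (flowBox f E' t₁) ∈
      foliationGroupoid (EuclideanSpace ℝ (Fin 1)) (EuclideanSpace ℝ (Fin 2)) :=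
  ⟨isFoliatedOn_transition E E' t₀ t₁, isFoliatedOn_transition E' E t₁ t₀⟩

variable (f)

/-- The charted space structure of the suspension given by the flow boxes. -/
@[reducible]
noncomputable def flowBoxCharts (c : X → OpenPartialHomeomorph X (EuclideanSpace ℝ (Fin 2)))
    (hc : ∀ x, x ∈ (c x).source) :
    ChartedSpace (EuclideanSpace ℝ (Fin 1) × EuclideanSpace ℝ (Fin 2)) (Suspension f) where
  atlas := {e | ∃ x t₀, e = flowBox f (c x) t₀}
  chartAt z := flowBox f (c (exists_mk f z).choose) (exists_mk f z).choose_spec.choose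
  mem_chart_source z := by
    have h := (exists_mk f z).choose_spec.choose_spec
    have hm := mk_mem_flowBox_source (f := f) (hc (exists_mk f z).choose)
      (mem_window (exists_mk f z).choose_spec.choose)
    rwa [h] at hm
  chart_mem_atlas z := ⟨_, _, rfl⟩

/-- The foliation of the suspension by flow lines. -/
noncomputable def flowFoliation (c : X → OpenPartialHomeomorph X (EuclideanSpace ℝ (Fin 2)))
    (hc : ∀ x, x ∈ (c x).source) : Foliation 1 2 (Suspension f) where
  charted := flowBoxCharts f c hc
  compatible := by
    let := flowBoxCharts f c hc
    refine ⟨?_⟩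
    rintro _ _ ⟨x, t₀, rfl⟩ ⟨y, t₁, rfl⟩
    exact transition_mem_foliationGroupoid _ _ _ _

variable (c : X → OpenPartialHomeomorph X (EuclideanSpace ℝ (Fin 2)))
  (hc : ∀ x, x ∈ (c x).source)

theorem continuous_flow_leafTopology (z : Suspension f) :
    Continuous[_, (flowFoliation f c hc).leafTopology] fun t : ℝ => flow f t z := by
  rw [continuous_generateFrom_iff]
  rintro _ ⟨_, ⟨x₀, t₀, rfl⟩, b, U, hU, rfl⟩
  rw [isOpen_iff_mem_nhds]
  rintro t ⟨htU, hts, htb⟩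
  obtain ⟨y, hy, s, hs, hys⟩ := exists_of_mem_flowBox_source hts
  have hflow : ∀ r, flow f r z = mk f (y, s + (r - t)) := by
    intro r
    rw [← flow_mk, hys, ← Flow.map_add, sub_add_cancel]
  have hcont : Continuous fun r : ℝ => flow f r z :=
    (flow f).continuous continuous_id continuous_const
  rw [← hys, flowBox_mk hs] at htb
  have hopen : IsOpen ((fun r : ℝ => s + (r - t)) ⁻¹' Ioo (t₀ - 1 / 2) (t₀ + 1 / 2)) :=
    isOpen_Ioo.preimage (by fun_prop)
  filter_upwards [(hU.preimage hcont).mem_nhds htU, hopen.mem_nhds (by simpa using hs)]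
    with r hrU hr
  refine ⟨hrU, ?_, ?_⟩
  · simp only [hflow]
    exact mk_mem_flowBox_source hy hr
  · simp only [hflow]
    rw [flowBox_mk hr]
    exact htb

/-- The plaque of a point: the points of its flow box at the same level. -/
theorem exists_plaque (z : Suspension f) :
    ∃ P : Set (Suspension f), IsOpen[(flowFoliation f c hc).leafTopology] P ∧ z ∈ P ∧
      ∃ (x : X) (t₀ : ℝ), ∀ w ∈ P, ∃ s ∈ Ioo (t₀ - 1 / 2) (t₀ + 1 / 2), w = mk f (x, s) := by
  obtain ⟨x, t₀, rfl⟩ := exists_mk f z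
  have ht₀ := mem_window t₀
  refine ⟨_, TopologicalSpace.isOpen_generateFrom_of_mem
    ⟨flowBox f (c x) t₀, ⟨x, t₀, rfl⟩, c x x, univ, isOpen_univ, rfl⟩, ⟨trivial,
    mk_mem_flowBox_source (hc x) ht₀, by rw [flowBox_mk ht₀]⟩, x, t₀, ?_⟩
  rintro w ⟨-, hw, hwx⟩
  obtain ⟨y, hy, s, hs, rfl⟩ := exists_of_mem_flowBox_source hw
  rw [flowBox_mk hs] at hwx
  exact ⟨s, hs, by rw [(c x).injOn hy (hc x) hwx]⟩

theorem _root_.connectedComponent_eq_of_isClopen {Z : Type*} [TopologicalSpace Z] {O : Set Z}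
    {z : Z} (hO : IsClopen O) (hc : IsPreconnected O) (hz : z ∈ O) : connectedComponent z = O :=
  (hO.connectedComponent_subset hz).antisymm (hc.subset_connectedComponent hz)

/-- Each plaque lies in one flow line, so flow lines are open in the leaf topology. They partition
the space, hence are also closed, and they are connected as continuous images of `ℝ`. -/
theorem isInducedFoliation_flowFoliation : IsInducedFoliation f (flowFoliation f c hc) := by
  have hopen : ∀ z, IsOpen[(flowFoliation f c hc).leafTopology]
      (range fun t : ℝ => flow f t z) := by
    intro z
    rw [@isOpen_iff_mem_nhds _ (flowFoliation f c hc).leafTopology _]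
    rintro _ ⟨r, rfl⟩
    obtain ⟨P, hP, hzP, x, t₀, hPx⟩ := exists_plaque f c hc (flow f r z)
    refine Filter.mem_of_superset
      (@IsOpen.mem_nhds _ (flowFoliation f c hc).leafTopology _ _ hP hzP) fun w hw => ?_
    obtain ⟨s, -, hs⟩ := hPx _ hzP
    obtain ⟨s', -, rfl⟩ := hPx _ hw
    refine ⟨s' - s + r, ?_⟩
    simp only [Flow.map_add, hs, flow_mk]
    congr 2
    ring
  have hdisj : ∀ z, (range fun t : ℝ => flow f t z)ᶜ =
      ⋃ w ∈ (range fun t : ℝ => flow f t z)ᶜ, range fun t : ℝ => flow f t w := by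
    intro z
    ext w
    constructor
    · exact fun hw => mem_iUnion₂.2 ⟨w, hw, 0, by simp⟩
    · intro hw
      obtain ⟨u, hu, r, rfl⟩ := mem_iUnion₂.1 hw
      rintro ⟨r', hr'⟩
      refine hu ⟨-r + r', ?_⟩
      simp only at hr'
      simp only [Flow.map_add, hr']
      rw [← Flow.map_add]
      simp
  intro z
  refine @connectedComponent_eq_of_isClopen _ (flowFoliation f c hc).leafTopology _ _
    ⟨?_, hopen z⟩ ?_ ⟨0, by simp⟩
  · rw [← @isOpen_compl_iff _ _ (flowFoliation f c hc).leafTopology, hdisj z]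
    exact @isOpen_biUnion _ _ (flowFoliation f c hc).leafTopology _ _ fun w _ => hopen w
  · exact @isPreconnected_range _ _ _ (flowFoliation f c hc).leafTopology _ _
      (continuous_flow_leafTopology f c hc z)

/-- Finitely many plaques cover the leaf, so two of the points `[x, n]` share a plaque. -/
theorem exists_pow_apply_eq_of_isCompact_orbit {x : X}
    (hx : @IsCompact _ (flowFoliation f c hc).leafTopology
      (range fun t : ℝ => flow f t (mk f (x, 0)))) : ∃ n : ℕ, 0 < n ∧ (f ^ n) x = x := by
  choose P hP hzP y t₀ hPy using exists_plaque f c hc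
  obtain ⟨t, -, ht⟩ := @IsCompact.elim_nhds_subcover _ (flowFoliation f c hc).leafTopology _ hx P
    fun z _ => @IsOpen.mem_nhds _ (flowFoliation f c hc).leafTopology _ _ (hP z) (hzP z)
  have hcover : ∀ n : ℤ, ∃ z : t, mk f (x, (n : ℝ)) ∈ P z := by
    intro n
    obtain ⟨z, hz, hn⟩ := mem_iUnion₂.1 (ht ⟨(n : ℝ), rfl⟩)
    simp only [flow_mk, zero_add] at hn
    exact ⟨⟨z, hz⟩, hn⟩
  choose z hz using hcover
  obtain ⟨n, m, hnm, hzz⟩ := Finite.exists_ne_map_eq_of_infinite z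
  obtain ⟨s, hs, hns⟩ := hPy _ _ (hz n)
  obtain ⟨s', hs', hms⟩ := hPy _ _ (hz m)
  rw [← hzz] at hs' hms
  obtain ⟨a, ha, has⟩ := (mk_eq_mk_iff f).1 hns
  obtain ⟨b, hb, hbs⟩ := (mk_eq_mk_iff f).1 hms
  simp only at ha hb has hbs
  -- A time window has length one and is open, so distinct integer times in the same plaque need
  -- different powers of `f`.
  have hab : a ≠ b := by
    rintro rfl
    simp only [mem_Ioo] at hs hs'
    have h1 : (n : ℝ) - m < 1 := by linarith
    have h2 : (-1 : ℝ) < n - m := by linarith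
    have h1 : n - m < 1 := by exact_mod_cast h1
    have h2 : -1 < n - m := by exact_mod_cast h2
    exact hnm (by lia)
  have key : ∀ {a b : ℤ}, a < b → (f ^ a) x = (f ^ b) x → ∃ n : ℕ, 0 < n ∧ (f ^ n) x = x := by
    intro a b hlt h
    refine ⟨(b - a).toNat, by lia, ?_⟩
    apply (f ^ a).injective
    rw [← zpow_natCast, Int.toNat_of_nonneg (by lia), ← Homeomorph.mul_apply, ← zpow_add,
      add_sub_cancel, h]
  rcases hab.lt_or_gt with h | h
  exacts [key h (ha.symm.trans hb), key h (hb.symm.trans ha)]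

end Suspension

/-! ### Rotations about an axis -/

/-- Removing a finite fiber from the plane leaves it connected, so by the intermediate value theorem
a nonconstant function cannot omit an intermediate value there. -/
theorem not_forall_finite_fiber {M : Type*} [TopologicalSpace M] (E : OpenPartialHomeomorph M ℂ)
    {a : M} (ha : a ∈ E.source) {u : M → ℝ} (hu : Continuous u) :
    ¬ ∀ t, (u ⁻¹' {t}).Finite := by
  intro hfin
  obtain ⟨r, hr, hball⟩ := Metric.isOpen_iff.1 E.open_target _ (E.map_source ha)
  let φ := OpenPartialHomeomorph.univBall (E a) r
  have hφt : ∀ z, φ z ∈ E.target := fun z => hball (by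
    have := φ.map_source (x := z) (by simp [φ])
    rwa [OpenPartialHomeomorph.univBall_target _ hr] at this)
  let w : ℂ → ℝ := fun z => u (E.symm (φ z))
  have hφ : Continuous φ := OpenPartialHomeomorph.continuous_univBall _ _
  have hw : Continuous w :=
    hu.comp (E.symm.continuousOn.comp_continuous hφ hφt)
  have hinj : Function.Injective fun z => E.symm (φ z) := by
    intro y z h
    exact φ.injOn (by simp [φ]) (by simp [φ]) (E.symm.injOn (hφt y) (hφt z) h)
  have hwfin : ∀ t, (w ⁻¹' {t}).Finite := fun t =>
    Set.Finite.preimage (f := fun z => E.symm (φ z)) hinj.injOn (hfin t)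
  obtain ⟨z, hz⟩ : ∃ z, w z ≠ w 0 := by
    by_contra hcon
    push Not at hcon
    exact infinite_univ ((hwfin (w 0)).subset fun z _ => hcon z)
  have hconn : IsPreconnected (w '' (w ⁻¹' {(w z + w 0) / 2})ᶜ) :=
    ((hwfin _).countable.isPathConnected_compl_of_one_lt_rank (by
      rw [Complex.rank_real_complex]; exact Nat.one_lt_ofNat)).isConnected.isPreconnected.image _
      hw.continuousOn
  have hne : w z ≠ (w z + w 0) / 2 ∧ w 0 ≠ (w z + w 0) / 2 :=
    ⟨fun h => hz (by linarith), fun h => hz (by linarith)⟩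
  have hmem : (w z + w 0) / 2 ∈ w '' (w ⁻¹' {(w z + w 0) / 2})ᶜ := by
    refine hconn.ordConnected.uIcc_subset (mem_image_of_mem _ hne.1) (mem_image_of_mem _ hne.2) ?_
    rw [mem_uIcc]
    rcases le_total (w z) (w 0) with h | h
    · left; constructor <;> linarith
    · right; constructor <;> linarith
  obtain ⟨y, hy, hy'⟩ := hmem
  exact hy hy'

section AxisRotation

@[simp] theorem axisRotation_apply_zero (θ : ℝ) (v : EuclideanSpace ℝ (Fin 3)) :
    axisRotation θ v 0 = Real.cos θ * v 0 - Real.sin θ * v 1 := rfl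

@[simp] theorem axisRotation_apply_one (θ : ℝ) (v : EuclideanSpace ℝ (Fin 3)) :
    axisRotation θ v 1 = Real.sin θ * v 0 + Real.cos θ * v 1 := rfl

@[simp] theorem axisRotation_apply_two (θ : ℝ) (v : EuclideanSpace ℝ (Fin 3)) :
    axisRotation θ v 2 = v 2 := rfl

theorem EuclideanSpace.ext_three {v w : EuclideanSpace ℝ (Fin 3)} (h0 : v 0 = w 0)
    (h1 : v 1 = w 1) (h2 : v 2 = w 2) : v = w := by
  ext i
  fin_cases i
  exacts [h0, h1, h2]

theorem axisRotation_add (θ φ : ℝ) (v : EuclideanSpace ℝ (Fin 3)) :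
    axisRotation (θ + φ) v = axisRotation θ (axisRotation φ v) := by
  apply EuclideanSpace.ext_three <;>
    simp only [axisRotation_apply_zero, axisRotation_apply_one, axisRotation_apply_two,
      Real.cos_add, Real.sin_add] <;> ring

@[simp] theorem axisRotation_zero (v : EuclideanSpace ℝ (Fin 3)) : axisRotation 0 v = v := by
  apply EuclideanSpace.ext_three <;> simp

theorem Continuous.axisRotation {Z : Type*} [TopologicalSpace Z] {a : Z → ℝ}
    {b : Z → EuclideanSpace ℝ (Fin 3)} (ha : Continuous a) (hb : Continuous b) :
    Continuous fun z => _root_.axisRotation (a z) (b z) := by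
  unfold _root_.axisRotation
  refine (PiLp.continuous_toLp 2 _).comp (continuous_pi fun i => ?_)
  fin_cases i <;> simp <;> fun_prop

theorem axisRotation_two_pi_int (n : ℤ) (v : EuclideanSpace ℝ (Fin 3)) :
    axisRotation (n * (2 * Real.pi)) v = v := by
  have : Real.sin (n * (2 * Real.pi)) = 0 := by
    rw [← mul_assoc]
    exact_mod_cast Real.sin_int_mul_pi (n * 2)
  apply EuclideanSpace.ext_three <;> simp [this]

/-- The squared distance to the axis. -/
def axisDistSq (v : EuclideanSpace ℝ (Fin 3)) : ℝ := v 0 ^ 2 + v 1 ^ 2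

theorem continuous_axisDistSq : Continuous axisDistSq := by
  unfold axisDistSq
  fun_prop

theorem axisDistSq_axisRotation (θ : ℝ) (v : EuclideanSpace ℝ (Fin 3)) :
    axisDistSq (axisRotation θ v) = axisDistSq v := by
  simp only [axisDistSq, axisRotation_apply_zero, axisRotation_apply_one]
  linear_combination (v 0 ^ 2 + v 1 ^ 2) * Real.sin_sq_add_cos_sq θ

theorem exists_axisRotation_eq {v w : EuclideanSpace ℝ (Fin 3)} (h : axisDistSq w = axisDistSq v)
    (h2 : w 2 = v 2) : ∃ θ, axisRotation θ v = w := by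
  let z : ℂ := ⟨v 0, v 1⟩
  let y : ℂ := ⟨w 0, w 1⟩
  have hn : ‖y‖ = ‖z‖ := by
    rw [← sq_eq_sq₀ (norm_nonneg _) (norm_nonneg _), Complex.sq_norm, Complex.sq_norm,
      Complex.normSq_mk, Complex.normSq_mk]
    simp only [axisDistSq] at h
    linarith
  have hz0 : ‖z‖ * Real.cos z.arg = v 0 := Complex.norm_mul_cos_arg z
  have hz1 : ‖z‖ * Real.sin z.arg = v 1 := Complex.norm_mul_sin_arg z
  have hy0 : ‖z‖ * Real.cos y.arg = w 0 := hn ▸ Complex.norm_mul_cos_arg y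
  have hy1 : ‖z‖ * Real.sin y.arg = w 1 := hn ▸ Complex.norm_mul_sin_arg y
  refine ⟨y.arg - z.arg, EuclideanSpace.ext_three ?_ ?_ h2.symm⟩
  · rw [axisRotation_apply_zero, ← hz0, ← hz1, ← hy0, Real.cos_sub, Real.sin_sub]
    linear_combination ‖z‖ * Real.cos y.arg * Real.sin_sq_add_cos_sq z.arg
  · rw [axisRotation_apply_one, ← hz0, ← hz1, ← hy1, Real.cos_sub, Real.sin_sub]
    linear_combination ‖z‖ * Real.sin y.arg * Real.sin_sq_add_cos_sq z.arg

theorem axisRotation_image_eq {S : Set (EuclideanSpace ℝ (Fin 3))}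
    (hS : ∀ θ, ∀ v ∈ S, axisRotation θ v ∈ S) (θ : ℝ) : axisRotation θ '' S = S := by
  refine Subset.antisymm (image_subset_iff.2 (hS θ)) fun v hv => ⟨_, hS (-θ) v hv, ?_⟩
  rw [← axisRotation_add, add_neg_cancel, axisRotation_zero]

theorem axisDistSq_eq_zero_of_axisRotation_eq {θ : ℝ} (hθ : Real.cos θ ≠ 1)
    {v : EuclideanSpace ℝ (Fin 3)} (hv : axisRotation θ v = v) : axisDistSq v = 0 := by
  have h0 : Real.cos θ * v 0 - Real.sin θ * v 1 = v 0 := congrArg (fun w => w 0) hv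
  have h1 : Real.sin θ * v 0 + Real.cos θ * v 1 = v 1 := congrArg (fun w => w 1) hv
  have : (1 - Real.cos θ) * axisDistSq v = 0 := by
    simp only [axisDistSq]
    linear_combination -v 0 * h0 - v 1 * h1
  exact (mul_eq_zero.1 this).resolve_left (sub_ne_zero.2 hθ.symm)

end AxisRotation

section Axisymmetric

variable {M : Type*} [TopologicalSpace M] {ι : M → EuclideanSpace ℝ (Fin 3)}

theorem IsAxisymmetricEmbedding.exists_rotation (hι : IsAxisymmetricEmbedding ι) :
    ∃ g : ℝ → M → M, ∀ θ x, ι (g θ x) = axisRotation θ (ι x) := by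
  have : ∀ θ x, ∃ y, ι y = axisRotation θ (ι x) := fun θ x => by
    rw [← mem_range, ← hι.2 θ]
    exact mem_image_of_mem _ (mem_range_self x)
  choose g hg using this
  exact ⟨g, hg⟩

theorem IsAxisymmetricEmbedding.exists_homeomorph (hι : IsAxisymmetricEmbedding ι) (θ : ℝ) :
    ∃ f : M ≃ₜ M, ∀ x, ι (f x) = axisRotation θ (ι x) := by
  obtain ⟨g, hg⟩ := hι.exists_rotation
  have hgc : ∀ θ, Continuous (g θ) := fun θ => by
    rw [hι.1.continuous_iff]
    have : ι ∘ g θ = fun x => axisRotation θ (ι x) := funext (hg θ)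
    rw [this]
    exact continuous_const.axisRotation hι.1.continuous
  have hinv : ∀ θ x, g (-θ) (g θ x) = x := fun θ x => hι.1.injective (by
    rw [hg, hg, ← axisRotation_add, neg_add_cancel, axisRotation_zero])
  exact ⟨{ toFun := g θ
           invFun := g (-θ)
           left_inv := hinv θ
           right_inv := fun x => by simpa using hinv (-θ) x
           continuous_toFun := hgc θ
           continuous_invFun := hgc (-θ) }, hg θ⟩

theorem map_zpow_eq_axisRotation {θ : ℝ} {f : M ≃ₜ M}
    (hf : ∀ x, ι (f x) = axisRotation θ (ι x)) (n : ℤ) (x : M) :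
    ι ((f ^ n) x) = axisRotation (n * θ) (ι x) := by
  induction n with
  | zero => simp
  | succ n ih =>
    rw [add_comm, zpow_add, zpow_one, Homeomorph.mul_apply, hf, ih, ← axisRotation_add]
    congr 1
    push_cast; ring
  | pred n ih =>
    have h1 : f ((f ^ (-(n : ℤ) - 1)) x) = (f ^ (-(n : ℤ))) x := by
      rw [← Homeomorph.mul_apply, ← zpow_one_add]
      congr 2
      ring
    have h2 := hf ((f ^ (-(n : ℤ) - 1)) x)
    rw [h1, ih] at h2
    have h3 := congrArg (axisRotation (-θ)) h2
    rw [← axisRotation_add, ← axisRotation_add, neg_add_cancel, axisRotation_zero] at h3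
    rw [← h3]
    congr 1
    push_cast; ring

/-- Height and distance to the axis are invariant; conversely points sharing them differ by a
rotation, and the angles `2πα m + 2π n` are dense. -/
theorem mem_closure_orbit_iff (hι : IsAxisymmetricEmbedding ι) {α : ℝ} (hα : Irrational α)
    {f : M ≃ₜ M} (hf : ∀ x, ι (f x) = axisRotation (2 * Real.pi * α) (ι x)) {x y : M} :
    y ∈ closure (homeoOrbit f x) ↔ axisDistSq (ι y) = axisDistSq (ι x) ∧ ι y 2 = ι x 2 := by
  have hιc := hι.1.continuous
  constructor
  · have hcl : IsClosed {y | axisDistSq (ι y) = axisDistSq (ι x) ∧ ι y 2 = ι x 2} :=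
      (isClosed_eq (continuous_axisDistSq.comp hιc) continuous_const).inter
        (isClosed_eq (by fun_prop) continuous_const)
    refine fun hy => hcl.closure_subset_iff.2 ?_ hy
    rintro _ ⟨n, rfl⟩
    simp [map_zpow_eq_axisRotation hf, axisDistSq_axisRotation]
  · rintro ⟨h1, h2⟩
    obtain ⟨θ, hθ⟩ := exists_axisRotation_eq h1 h2
    obtain ⟨g, hg⟩ := hι.exists_rotation
    have hgy : g θ x = y := hι.1.injective (by rw [hg, hθ])
    have hgc : Continuous fun θ => g θ x := by
      rw [hι.1.continuous_iff]
      have : (ι ∘ fun θ => g θ x) = fun θ => axisRotation θ (ι x) := funext fun θ => hg θ x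
      rw [this]
      exact continuous_id.axisRotation continuous_const
    have hpi : (2 * Real.pi) ≠ 0 := Real.two_pi_pos.ne'
    have hd : Dense (AddSubgroup.closure {2 * Real.pi * α, 2 * Real.pi} : Set ℝ) := by
      rw [dense_addSubgroupClosure_pair_iff, mul_div_cancel_left₀ _ hpi]
      exact hα
    rw [← hgy]
    refine closure_mono ?_ (image_closure_subset_closure_image hgc (mem_image_of_mem _ (hd θ)))
    rintro _ ⟨φ, hφ, rfl⟩
    obtain ⟨m, n, rfl⟩ := AddSubgroup.mem_closure_pair.1 hφ
    refine ⟨m, hι.1.injective ?_⟩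
    simp only [map_zpow_eq_axisRotation hf, hg, zsmul_eq_mul, axisRotation_add,
      axisRotation_two_pi_int]

theorem IsAxisymmetricEmbedding.exists_irrational_rotation (hι : IsAxisymmetricEmbedding ι)
    (E : OpenPartialHomeomorph M ℂ) {a : M} (ha : a ∈ E.source) {α : ℝ} (hα : Irrational α) :
    ∃ f : M ≃ₜ M, (∀ x, ι (f x) = axisRotation (2 * Real.pi * α) (ι x)) ∧
      IsRClosedHomeo f ∧ ¬ IsMinimalHomeo f ∧ ¬ IsPeriodicHomeo f := by
  obtain ⟨f, hf⟩ := hι.exists_homeomorph (2 * Real.pi * α)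
  have hιc := hι.1.continuous
  refine ⟨f, hf, ?_, fun hmin => ?_, ?_⟩
  · have : {p : M × M | p.2 ∈ closure (homeoOrbit f p.1)} =
        {p | axisDistSq (ι p.2) = axisDistSq (ι p.1) ∧ ι p.2 2 = ι p.1 2} := by
      ext p
      exact mem_closure_orbit_iff hι hα hf
    rw [IsRClosedHomeo, RClosed, this]
    exact (isClosed_eq (continuous_axisDistSq.comp (by fun_prop))
      (continuous_axisDistSq.comp (by fun_prop))).inter (isClosed_eq (by fun_prop) (by fun_prop))
  -- A dense orbit would place `M` in one circle, where the first coordinate has at most two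
  -- preimages.
  · have hall := fun y => (mem_closure_orbit_iff hι hα hf).1 (hmin a y)
    refine not_forall_finite_fiber E ha (u := fun x => ι x 0) (by fun_prop) fun t => ?_
    refine Finite.of_finite_image (f := ι) (Set.Finite.subset (s := {!₂[t, √(axisDistSq (ι a) - t ^ 2), ι a 2],
      !₂[t, -√(axisDistSq (ι a) - t ^ 2), ι a 2]}) (by simp) ?_) hι.1.injective.injOn
    rintro _ ⟨x, rfl, rfl⟩
    obtain ⟨h1, h2⟩ := hall x
    have h3 : √(axisDistSq (ι a) - ι x 0 ^ 2) = |ι x 1| := by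
      rw [← h1, axisDistSq, add_sub_cancel_left, Real.sqrt_sq_eq_abs]
    rw [h3]
    rcases abs_choice (ι x 1) with h | h
    · left; exact EuclideanSpace.ext_three rfl h.symm h2
    · right; exact EuclideanSpace.ext_three rfl (by simp [h]) h2
  · rintro ⟨n, hn, hfn⟩
    have hcos : Real.cos ((n : ℤ) * (2 * Real.pi * α)) ≠ 1 := by
      intro h
      obtain ⟨k, hk⟩ := (Real.cos_eq_one_iff _).1 h
      have hn' : (n : ℝ) ≠ 0 := by exact_mod_cast hn.ne'
      refine hα ⟨k / n, ?_⟩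
      push_cast at hk ⊢
      field_simp
      have := Real.pi_pos
      refine mul_left_cancel₀ Real.two_pi_pos.ne' ?_
      linarith
    -- A nontrivial rotation fixes only the axis, and on the axis the height is injective.
    have hax : ∀ x, axisDistSq (ι x) = 0 := fun x => by
      refine axisDistSq_eq_zero_of_axisRotation_eq hcos ?_
      rw [← map_zpow_eq_axisRotation hf, zpow_natCast, hfn]
      rfl
    refine not_forall_finite_fiber E ha (u := fun x => ι x 2) (by fun_prop) fun t => ?_
    refine Set.Subsingleton.finite fun x hx y hy => hι.1.injective ?_
    have h0 : ∀ x, ι x 0 = 0 ∧ ι x 1 = 0 := fun x => by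
      have := hax x
      simp only [axisDistSq] at this
      constructor <;> nlinarith [sq_nonneg (ι x 0), sq_nonneg (ι x 1)]
    exact EuclideanSpace.ext_three (by rw [(h0 x).1, (h0 y).1]) (by rw [(h0 x).2, (h0 y).2])
      (by rw [show ι x 2 = t from hx, show ι y 2 = t from hy])

end Axisymmetric

/-! ### The standard sphere and torus of revolution -/

theorem isAxisymmetricEmbedding_sphere :
    IsAxisymmetricEmbedding (Subtype.val : Sphere2 → EuclideanSpace ℝ (Fin 3)) := by
  refine ⟨.subtypeVal, axisRotation_image_eq ?_⟩
  rw [Subtype.range_coe]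
  intro θ v hv
  rw [mem_sphere_zero_iff_norm, EuclideanSpace.norm_eq] at hv ⊢
  have := axisDistSq_axisRotation θ v
  simp only [axisDistSq] at this
  simp only [Fin.sum_univ_three, Real.norm_eq_abs, sq_abs] at hv ⊢
  rw [this, axisRotation_apply_two, hv]

theorem isAxisymmetricEmbedding_torus :
    IsAxisymmetricEmbedding fun p : Torus2 => (!₂[(2 + (p.2 : ℂ).re) * (p.1 : ℂ).re,
      (2 + (p.2 : ℂ).re) * (p.1 : ℂ).im, (p.2 : ℂ).im] : EuclideanSpace ℝ (Fin 3)) := by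
  have hsq : ∀ z : Circle, (z : ℂ).re ^ 2 + (z : ℂ).im ^ 2 = 1 := fun z => by
    have := Circle.normSq_coe z
    rw [Complex.normSq_apply] at this
    linarith
  refine ⟨(Continuous.isClosedEmbedding ?_ ?_).isEmbedding, axisRotation_image_eq ?_⟩
  · refine (PiLp.continuous_toLp 2 _).comp (continuous_pi fun i => ?_)
    have h1 : Continuous fun p : Torus2 => (p.1 : ℂ) := by fun_prop
    have h2 : Continuous fun p : Torus2 => (p.2 : ℂ) := by fun_prop
    fin_cases i <;> simp <;> fun_prop
  · rintro ⟨z, w⟩ ⟨z', w'⟩ h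
    have h0 : (2 + (w : ℂ).re) * (z : ℂ).re = (2 + (w' : ℂ).re) * (z' : ℂ).re :=
      congrArg (fun v : EuclideanSpace ℝ (Fin 3) => v 0) h
    have h1 : (2 + (w : ℂ).re) * (z : ℂ).im = (2 + (w' : ℂ).re) * (z' : ℂ).im :=
      congrArg (fun v : EuclideanSpace ℝ (Fin 3) => v 1) h
    have h2 : (w : ℂ).im = (w' : ℂ).im :=
      congrArg (fun v : EuclideanSpace ℝ (Fin 3) => v 2) h
    have hw : -1 ≤ (w : ℂ).re := by nlinarith [hsq w, sq_nonneg (w : ℂ).im]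
    have hw' : -1 ≤ (w' : ℂ).re := by nlinarith [hsq w', sq_nonneg (w' : ℂ).im]
    -- Both sides are positive distances to the axis, so it suffices to compare squares, which are
    -- the sums of the squares of the first two coordinates.
    have hre : (2 + (w : ℂ).re) = (2 + (w' : ℂ).re) := by
      rw [← sq_eq_sq₀ (by linarith) (by linarith)]
      linear_combination -(2 + (w : ℂ).re) ^ 2 * hsq z + (2 + (w' : ℂ).re) ^ 2 * hsq z' +
        ((2 + (w : ℂ).re) * (z : ℂ).re + (2 + (w' : ℂ).re) * (z' : ℂ).re) * h0 +
        ((2 + (w : ℂ).re) * (z : ℂ).im + (2 + (w' : ℂ).re) * (z' : ℂ).im) * h1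
    have hne : 2 + (w' : ℂ).re ≠ 0 := by linarith
    rw [hre] at h0 h1
    exact Prod.ext (Circle.ext (Complex.ext (mul_left_cancel₀ hne h0) (mul_left_cancel₀ hne h1)))
      (Circle.ext (Complex.ext (by linarith) h2))
  · rintro θ _ ⟨⟨z, w⟩, rfl⟩
    refine ⟨(Circle.exp θ * z, w), EuclideanSpace.ext_three ?_ ?_ rfl⟩
    · simp [Circle.coe_exp, Complex.exp_ofReal_mul_I_re, Complex.exp_ofReal_mul_I_im]
      ring
    · simp [Circle.coe_exp, Complex.exp_ofReal_mul_I_re, Complex.exp_ofReal_mul_I_im]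
      ring

/-! ### Topology of the two surfaces and conclusion -/

section Surfaces

/-- A topological space in which every point has a chart to the plane. -/
def IsLocallyPlanar (M : Type*) [TopologicalSpace M] : Prop :=
  ∀ x : M, ∃ E : OpenPartialHomeomorph M (EuclideanSpace ℝ (Fin 2)), x ∈ E.source

theorem IsLocallyPlanar.of_homeomorph {M N : Type*} [TopologicalSpace M] [TopologicalSpace N]
    (g : M ≃ₜ N) (hN : IsLocallyPlanar N) : IsLocallyPlanar M := fun x => by
  obtain ⟨E, hE⟩ := hN (g x)
  exact ⟨g.toOpenPartialHomeomorph.trans E, by simpa using hE⟩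

theorem IsLocallyPlanar.exists_complex_chart {M : Type*} [TopologicalSpace M]
    (hM : IsLocallyPlanar M) (x : M) : ∃ E : OpenPartialHomeomorph M ℂ, x ∈ E.source := by
  obtain ⟨E, hE⟩ := hM x
  have L : EuclideanSpace ℝ (Fin 2) ≃L[ℝ] ℂ := .ofFinrankEq (by simp)
  exact ⟨E.trans L.toHomeomorph.toOpenPartialHomeomorph, by simpa using hE⟩

theorem isLocallyPlanar_torus : IsLocallyPlanar Torus2 := fun p => by
  have L : (EuclideanSpace ℝ (Fin 1) × EuclideanSpace ℝ (Fin 1)) ≃L[ℝ] EuclideanSpace ℝ (Fin 2) :=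
    .ofFinrankEq (by simp)
  refine ⟨((chartAt (EuclideanSpace ℝ (Fin 1)) p.1).prod
    (chartAt (EuclideanSpace ℝ (Fin 1)) p.2)).trans
    L.toHomeomorph.toOpenPartialHomeomorph, ?_⟩
  simp

theorem isLocallyPlanar_sphere : IsLocallyPlanar Sphere2 := fun p =>
  have : Fact (Module.finrank ℝ (EuclideanSpace ℝ (Fin 3)) = 2 + 1) := ⟨by simp⟩
  ⟨chartAt (EuclideanSpace ℝ (Fin 2)) p, mem_chart_source _ p⟩

theorem connectedSpace_sphere2 : ConnectedSpace Sphere2 :=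
  isConnected_iff_connectedSpace.1 (isConnected_sphere (by
    rw [← Module.finrank_eq_rank]
    simp) 0 zero_le_one)

theorem connectedSpace_torus2 : ConnectedSpace Torus2 := by
  have : ConnectedSpace Circle :=
    Function.Surjective.connectedSpace (f := Circle.exp) (fun z => ⟨_, Circle.exp_arg z⟩)
      Circle.exp.continuous
  infer_instance

variable {M : Type*} [TopologicalSpace M]

theorem IsTorusOrSphere.isLocallyPlanar (hM : IsTorusOrSphere M) : IsLocallyPlanar M := by
  rcases hM with ⟨⟨g⟩⟩ | ⟨⟨g⟩⟩
  exacts [isLocallyPlanar_torus.of_homeomorph g, isLocallyPlanar_sphere.of_homeomorph g]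

theorem IsTorusOrSphere.compactSpace (hM : IsTorusOrSphere M) : CompactSpace M := by
  rcases hM with ⟨⟨g⟩⟩ | ⟨⟨g⟩⟩
  exacts [g.symm.compactSpace, g.symm.compactSpace]

theorem IsTorusOrSphere.t2Space (hM : IsTorusOrSphere M) : T2Space M := by
  rcases hM with ⟨⟨g⟩⟩ | ⟨⟨g⟩⟩
  exacts [g.symm.t2Space, g.symm.t2Space]

theorem IsTorusOrSphere.secondCountableTopology (hM : IsTorusOrSphere M) :
    SecondCountableTopology M := by
  rcases hM with ⟨⟨g⟩⟩ | ⟨⟨g⟩⟩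
  exacts [g.secondCountableTopology, g.secondCountableTopology]

theorem IsTorusOrSphere.connectedSpace (hM : IsTorusOrSphere M) : ConnectedSpace M := by
  have := connectedSpace_torus2
  have := connectedSpace_sphere2
  rcases hM with ⟨⟨g⟩⟩ | ⟨⟨g⟩⟩
  exacts [g.symm.surjective.connectedSpace g.symm.continuous,
    g.symm.surjective.connectedSpace g.symm.continuous]

theorem IsTorusOrSphere.exists_irrational_rotation (hM : IsTorusOrSphere M)
    {ι : M → EuclideanSpace ℝ (Fin 3)} (hι : IsAxisymmetricEmbedding ι) {α : ℝ}
    (hα : Irrational α) :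
    ∃ f : M ≃ₜ M, (∀ x, ι (f x) = axisRotation (2 * Real.pi * α) (ι x)) ∧
      IsRClosedHomeo f ∧ ¬ IsMinimalHomeo f ∧ ¬ IsPeriodicHomeo f := by
  obtain ⟨a⟩ := hM.connectedSpace.toNonempty
  obtain ⟨E, hE⟩ := hM.isLocallyPlanar.exists_complex_chart a
  exact hι.exists_irrational_rotation E hE hα

theorem IsTorusOrSphere.exists_foliation (hM : IsTorusOrSphere M) {f : M ≃ₜ M}
    (hf : IsRClosedHomeo f) (hmin : ¬ IsMinimalHomeo f) (hper : ¬ IsPeriodicHomeo f) :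
    ∃ F : Foliation 1 2 (Suspension f), Suspension.IsInducedFoliation f F ∧
      F.IsRClosed ∧ ¬ F.IsMinimal ∧ ¬ F.IsCompactFoliation := by
  have := hM.connectedSpace
  have := hM.compactSpace
  have := hM.t2Space
  choose c hc using hM.isLocallyPlanar
  have hind := Suspension.isInducedFoliation_flowFoliation f c hc
  have hleaf : (Suspension.flowFoliation f c hc).leaf =
      fun z => range fun t : ℝ => Suspension.flow f t z := funext hind
  refine ⟨_, hind, ?_, fun hm => ?_, fun hcomp => ?_⟩
  · rw [Foliation.IsRClosed, hleaf]
    exact Suspension.rClosed_orbit f hf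
  · obtain ⟨z, hz⟩ := Suspension.not_dense_orbit f hmin
    exact hz (hind z ▸ hm z)
  · refine hper (isPeriodicHomeo_of_pointwise hM.isLocallyPlanar.exists_complex_chart f fun x => ?_)
    refine Suspension.exists_pow_apply_eq_of_isCompact_orbit f c hc ?_
    rw [← hind]
    exact hcomp _

end Surfaces

theorem mainTheorem7 :
    (∀ (M : Type*) [TopologicalSpace M], IsTorusOrSphere M →
      ∀ f : M ≃ₜ M, IsRClosedHomeo f → ¬ IsMinimalHomeo f → ¬ IsPeriodicHomeo f →
        T2Space (Suspension f) ∧ SecondCountableTopology (Suspension f) ∧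
        CompactSpace (Suspension f) ∧
        ∃ F : Foliation 1 2 (Suspension f), Suspension.IsInducedFoliation f F ∧
          F.IsRClosed ∧ ¬ F.IsMinimal ∧ ¬ F.IsCompactFoliation) ∧
    (∃ f : Torus2 ≃ₜ Torus2, IsRClosedHomeo f ∧ ¬ IsMinimalHomeo f ∧ ¬ IsPeriodicHomeo f) ∧
    (∃ f : Sphere2 ≃ₜ Sphere2, IsRClosedHomeo f ∧ ¬ IsMinimalHomeo f ∧ ¬ IsPeriodicHomeo f) ∧
    (∃ ι : Torus2 → EuclideanSpace ℝ (Fin 3), IsAxisymmetricEmbedding ι) ∧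
    (∃ ι : Sphere2 → EuclideanSpace ℝ (Fin 3), IsAxisymmetricEmbedding ι) ∧
    (∀ (M : Type*) [TopologicalSpace M], IsTorusOrSphere M →
      ∀ ι : M → EuclideanSpace ℝ (Fin 3), IsAxisymmetricEmbedding ι →
      ∀ α : ℝ, Irrational α →
        ∃ f : M ≃ₜ M, (∀ x, ι (f x) = axisRotation (2 * Real.pi * α) (ι x)) ∧
          IsRClosedHomeo f ∧ ¬ IsMinimalHomeo f ∧ ¬ IsPeriodicHomeo f) := by
  have hT : IsTorusOrSphere Torus2 := .inl ⟨.refl _⟩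
  have hS : IsTorusOrSphere Sphere2 := .inr ⟨.refl _⟩
  obtain ⟨fT, -, hfT⟩ := hT.exists_irrational_rotation isAxisymmetricEmbedding_torus
    irrational_sqrt_two
  obtain ⟨fS, -, hfS⟩ := hS.exists_irrational_rotation isAxisymmetricEmbedding_sphere
    irrational_sqrt_two
  refine ⟨fun M _ hM f hf hmin hper => ?_, ⟨fT, hfT⟩, ⟨fS, hfS⟩,
    ⟨_, isAxisymmetricEmbedding_torus⟩, ⟨_, isAxisymmetricEmbedding_sphere⟩,
    fun M _ hM ι hι α hα => hM.exists_irrational_rotation hι hα⟩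
  have := hM.compactSpace
  have := hM.t2Space
  have := hM.secondCountableTopology
  exact ⟨inferInstance, inferInstance, inferInstance, hM.exists_foliation hf hmin hper⟩
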